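/- Fix an integer $k\ge 1$, a real $\alpha\ge 1$ and a base $b>1$ of the logarithm. A $k$-decision list on $\{0,1\}^n$ is a list $(K_1,v_1),\dots,(K_r,v_r)$ in which each $K_j$ is a conjunction of at most $k$ literals over $x_1,\dots,x_n$, $v_j\in\{0,1\}$ and $K_r=\mathtt{true}$; its value at $x$ is $v_j$ for the least $j$ with $x\models K_j$. The class $k$-DL consists, for every $n$, of the functions so represented, and $\mathrm{size}(c)$ is the least size (number of nodes plus number of literal occurrences) of a $k$-decision list representing $c$. A distribution $D$ on $\{0,1\}^n$ is $\alpha$-log-Lipschitz if it has full support and $|\log D(x)-\log D(y)|\le\log\alpha$ whenever $d_H(x,y)=1$. For $\rho\geq 0$ the exact-in-the-ball robust risk is $\mathsf R^E_{\rho}(h,c)=\Pr_{x\sim D}[\exists z:\ d_H(x,z)\le\rho,\ h(z)\ne c(z)]$. An algorithm $\mathcal A$, which maps labelled samples to hypotheses $h:\{0,1\}^n\to\{0,1\}$, *efficiently $\rho$-robustly learns* a class $\mathcal C$ with respect to distribution classes $\mathcal D_n$ if there are polynomials $p,q$ such that for all $n$, $c\in\mathcal C_n$, $D\in\mathcal D_n$,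 $\varepsilon,\delta>0$ and all $m\ge p(n,1/\varepsilon,1/\delta,\mathrm{size}(c))$ the output $h=\mathcal A(S)$ on a sample $S\sim D^m$ labelled by $c$ satisfies $\Pr_{S\sim D^m}[\mathsf R^E_{\rho(n)}(h,c)<\varepsilon]>1-\delta$, and $h$ is polynomially evaluatable, i.e. always computed by a Boolean circuit of size at most $q(n,1/\varepsilon,1/\delta,\mathrm{size}(c))$. A *proper PAC learner with polynomial sample complexity* for $k$-DL is an algorithm that on every sample labelled by some $c\in k$-DL outputs an $h\in k$-DL, and for which there is a polynomial $p$ such that for all $n$, $c\in k$-DL, all distributions $D$ on $\{0,1\}^n$, $0<\varepsilon,\delta<1/2$ and $m\ge p(n,1/\varepsilon,1/\delta,\mathrm{size}(c))$, $\Pr_{S\sim D^m}[\Pr_{x\sim D}[h(x)\ne c(x)]\le\varepsilon]\ge 1-\delta$. **Corollary.** The class $k$-DL is efficiently $\log_b(n)$-robustly learnable with respect to the class of all $\alpha$-log-Lipschitz distributions, and any proper PAC learner can be used for this as a black box. Precisely: 1. Rivest's greedy algorithm for $k$-decision lists efficiently $\log_b(n)$-robustly learns $k$-DL with respect to the $\alpha$-log-Lipschitz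 distributions. 2. Rivest's algorithm is a proper PAC learner for $k$-DL with polynomial sample complexity; on $m$ examples of dimension $n$ it makes a number of steps polynomial in $n$ and $m$, and evaluating the decision list that it returns at any point takes a number of steps polynomial in $n$ and $m$ (the degree may depend on $k$). 3. Every proper PAC learner for $k$-DL with polynomial sample complexity efficiently $\log_b(n)$-robustly learns $k$-DL with respect to the $\alpha$-log-Lipschitz distributions. (The polynomials in 1 and 3 may depend on $k,\alpha,b$, and in 3 on the learner, but not on $n,c,D,\varepsilon,\delta$.) -/

import Mathlib

open MeasureTheory

/-! ### The Boolean hypercube, concept classes, distribution classes -/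

/-- The Boolean hypercube `{0,1}ⁿ`. -/
abbrev Cube (n : ℕ) : Type := Fin n → Bool

/-- A concept class: for every `n` a set of functions `{0,1}ⁿ → {0,1}`. -/
abbrev ConceptClass : Type := ∀ n : ℕ, Set (Cube n → Bool)

/-- A distribution class: for every `n` a set of probability distributions on `{0,1}ⁿ`. -/
abbrev DistributionClass : Type := ∀ n : ℕ, Set (PMF (Cube n))

/-- A learning algorithm seen as an input-output map: from `n` and a labelled sample of any
size `m` it produces a hypothesis `{0,1}ⁿ → {0,1}`. -/
abbrev Learner : Type :=
  ∀ n m : ℕ, (Fin m → Cube n × Bool) → (Cube n → Bool)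

/-- The sample `S` labelled according to the target concept `c`. -/
def labelled {n m : ℕ} (c : Cube n → Bool) (S : Fin m → Cube n) : Fin m → Cube n × Bool :=
  fun i => (S i, c (S i))

/-- The law `Dᵐ` of `m` independent points drawn from `D`. -/
noncomputable def sampleLaw {n : ℕ} (D : PMF (Cube n)) (m : ℕ) : Measure (Fin m → Cube n) :=
  Measure.pi fun _ => D.toMeasure

/-- `D` is `α`-log-Lipschitz: it has full support, and the logarithms of the masses of two
points at Hamming distance one differ by at most `log α`. -/
def IsLogLipschitz (α : ℝ) {n : ℕ} (D : PMF (Cube n)) : Prop :=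
  (∀ x, 0 < (D x).toReal) ∧
    ∀ x y : Cube n, hammingDist x y = 1 →
      |Real.log (D x).toReal - Real.log (D y).toReal| ≤ Real.log α

/-- The class of all `α`-log-Lipschitz distributions. -/
def logLipschitz (α : ℝ) : DistributionClass := fun _ => {D | IsLogLipschitz α D}

/-- The standard error `Pr_{x ∼ D}[c(x) ≠ h(x)]`. -/
noncomputable def stdError {n : ℕ} (D : PMF (Cube n)) (h c : Cube n → Bool) : ℝ :=
  D.toMeasure.real {x | c x ≠ h x}

/-- The exact-in-the-ball robust risk
`Pr_{x ∼ D}[∃ z, d_H(x, z) ≤ ρ and h(z) ≠ c(z)]`. -/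
noncomputable def robustRisk {n : ℕ} (D : PMF (Cube n)) (ρ : ℝ) (h c : Cube n → Bool) : ℝ :=
  D.toMeasure.real {x | ∃ z : Cube n, (hammingDist x z : ℝ) ≤ ρ ∧ h z ≠ c z}

/-! ### Boolean circuits -/

/-- A gate of a Boolean circuit with `n` inputs.  The arguments of a logical gate are positions
in the list of the values computed before it (a position outside of it carries `false`). -/
inductive Gate (n : ℕ) : Type
  | input (i : Fin n)
  | const (b : Bool)
  | not (a : ℕ)
  | and (a b : ℕ)
  | or (a b : ℕ)

/-- The value of a gate on the input `x`, given the values `vs` computed before it. -/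
def Gate.eval {n : ℕ} (x : Cube n) (vs : List Bool) : Gate n → Bool
  | .input i => x i
  | .const b => b
  | .not a => !(vs.getD a false)
  | .and a b => vs.getD a false && vs.getD b false
  | .or a b => vs.getD a false || vs.getD b false

/-- The values of all gates of a circuit.  The last gate of the circuit is the head of the list
and position `i` refers to the gate that comes `i + 1` places earlier. -/
def circuitValues {n : ℕ} (x : Cube n) : List (Gate n) → List Bool
  | [] => []
  | g :: gs => g.eval x (circuitValues x gs) :: circuitValues x gs

/-- `f` is computed by a Boolean circuit with at most `s` gates. -/
def HasCircuitOfSize {n : ℕ} (f : Cube n → Bool) (s : ℝ) : Prop :=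
  ∃ C : List (Gate n), (C.length : ℝ) ≤ s ∧ ∀ x, (circuitValues x C).head? = some (f x)

/-! ### PAC learning and robust learning -/

/-- The arguments `n, 1/ε, 1/δ, size(c)` of the polynomials below. -/
noncomputable def params (n : ℕ) (ε δ : ℝ) (s : ℕ) : Fin 4 → ℝ :=
  ![(n : ℝ), 1 / ε, 1 / δ, (s : ℝ)]

/-- `A` is a proper PAC learner for `C`, with polynomial sample complexity, for all
distributions. -/
def ProperlyPACLearns (A : Learner) (C : ConceptClass) (size : ∀ n, (Cube n → Bool) → ℕ) :
    Prop :=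
  (∀ n, ∀ c ∈ C n, ∀ (m : ℕ) (S : Fin m → Cube n), A n m (labelled c S) ∈ C n) ∧
  ∃ p : MvPolynomial (Fin 4) ℝ,
    ∀ n, ∀ c ∈ C n, ∀ D : PMF (Cube n),
    ∀ ε δ : ℝ, 0 < ε → ε < 1 / 2 → 0 < δ → δ < 1 / 2 →
    ∀ m : ℕ, p.eval (params n ε δ (size n c)) ≤ m →
      1 - δ ≤ (sampleLaw D m).real {S | stdError D (A n m (labelled c S)) c ≤ ε}

/-- `A` efficiently `ρ`-robustly learns `C` with respect to `𝒟`: its sample complexity is bounded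
by a polynomial `p`, and its hypotheses are polynomially evaluatable, that is, computed by
Boolean circuits of size bounded by a polynomial `q`. -/
def EfficientlyRobustlyLearns (A : Learner) (C : ConceptClass)
    (size : ∀ n, (Cube n → Bool) → ℕ) (𝒟 : DistributionClass) (ρ : ℕ → ℝ) : Prop :=
  ∃ p q : MvPolynomial (Fin 4) ℝ,
    ∀ n, ∀ c ∈ C n, ∀ D ∈ 𝒟 n, ∀ ε δ : ℝ, 0 < ε → 0 < δ →
    ∀ m : ℕ, p.eval (params n ε δ (size n c)) ≤ m →
      1 - δ < (sampleLaw D m).real {S | robustRisk D (ρ n) (A n m (labelled c S)) c < ε} ∧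
      ∀ S : Fin m → Cube n,
        HasCircuitOfSize (A n m (labelled c S)) (q.eval (params n ε δ (size n c)))

/-! ### Decision lists -/

/-- The literal `(i, true)` is `x_i`, the literal `(i, false)` is its negation. -/
abbrev Literal (n : ℕ) : Type := Fin n × Bool

/-- A conjunction of literals; the empty one is `true`. -/
abbrev Conj (n : ℕ) : Type := List (Literal n)

/-- `x` satisfies the conjunction `K`. -/
def Conj.sat {n : ℕ} (K : Conj n) (x : Cube n) : Bool := K.all fun l => x l.1 == l.2

/-- A list of pairs (conjunction, value). -/
abbrev DecList (n : ℕ) : Type := List (Conj n × Bool)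

/-- The value of the first node whose conjunction is satisfied (`false` if there is none, which
does not happen for a list that ends with the conjunction `true`). -/
def DecList.eval {n : ℕ} : DecList n → Cube n → Bool
  | [], _ => false
  | (K, v) :: L, x => if Conj.sat K x then v else DecList.eval L x

/-- `L` is a `k`-decision list: its conjunctions have at most `k` literals, and the last one
is `true`. -/
def DecList.IsKDL {n : ℕ} (k : ℕ) (L : DecList n) : Prop :=
  (∀ N ∈ L, N.1.length ≤ k) ∧ ∃ v, L.getLast? = some ([], v)

/-- The class `k`-DL. -/
def kDL (k : ℕ) : ConceptClass :=
  fun n => {f | ∃ L : DecList n, L.IsKDL k ∧ ∀ x, f x = L.eval x}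

/-- The size of a decision list: the number of its nodes plus the number of the occurrences of
literals in it. -/
def DecList.size {n : ℕ} (L : DecList n) : ℕ := (L.map fun N => N.1.length + 1).sum

/-- `size(c)`: the least size of a `k`-decision list that represents `c`. -/
noncomputable def kDLSize (k : ℕ) (n : ℕ) (c : Cube n → Bool) : ℕ :=
  sInf {s | ∃ L : DecList n, L.IsKDL k ∧ (∀ x, c x = L.eval x) ∧ L.size = s}

/-! ### Rivest's algorithm, with a count of its steps

A computation carries the number of steps that it has made.  One step is charged for every call
of a recursive procedure below and for every round of a loop; between two charges only a bounded
number of elementary operations is done (reading a bit `x_i` or a label, comparing two bits,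
extending a list by one element). -/

/-- A value together with the number of steps made to compute it. -/
structure Timed (β : Type) : Type where
  val : β
  steps : ℕ

instance : Monad Timed where
  pure b := ⟨b, 0⟩
  bind t f := ⟨(f t.val).val, t.steps + (f t.val).steps⟩

/-- One step. -/
def tick : Timed Unit := ⟨(), 1⟩

/-- Does `x` satisfy the conjunction? -/
def satT {n : ℕ} (x : Cube n) : Conj n → Timed Bool
  | [] => do tick; pure true
  | l :: K => do
    tick
    if x l.1 == l.2 then satT x K else pure false

/-- Evaluation of a decision list. -/
def evalT {n : ℕ} (x : Cube n) : DecList n → Timed Bool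
  | [] => do tick; pure false
  | (K, v) :: L => do
    tick
    if ← satT x K then pure v else evalT x L

/-- Is the conjunction satisfied by some example? -/
def someSatT {n : ℕ} (K : Conj n) : List (Cube n × Bool) → Timed Bool
  | [] => do tick; pure false
  | e :: S => do
    tick
    if ← satT e.1 K then pure true else someSatT K S

/-- Do all examples that satisfy the conjunction have the label `b`? -/
def allLabelT {n : ℕ} (K : Conj n) (b : Bool) : List (Cube n × Bool) → Timed Bool
  | [] => do tick; pure true
  | e :: S => do
    tick
    if (← satT e.1 K) && e.2 != b then pure false else allLabelT K b S

/-- Remove the examples that satisfy the conjunction. -/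
def removeT {n : ℕ} (K : Conj n) : List (Cube n × Bool) → Timed (List (Cube n × Bool))
  | [] => do tick; pure []
  | e :: S => do
    tick
    let R ← removeT K S
    if ← satT e.1 K then pure R else pure (e :: R)

/-- If the conjunction is satisfied by some example, and all examples that satisfy it have the
same label `b`, return the node `(K, b)`. -/
def nodeT {n : ℕ} (S : List (Cube n × Bool)) (K : Conj n) : Timed (Option (Conj n × Bool)) := do
  tick
  if ← someSatT K S then
    if ← allLabelT K false S then pure (some (K, false))
    else if ← allLabelT K true S then pure (some (K, true))
    else pure none
  else pure none

/-- A loop that stops at the first success. -/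
def firstT {ι β : Type} (f : ι → Timed (Option β)) : List ι → Timed (Option β)
  | [] => do tick; pure none
  | i :: is => do
    tick
    match ← f i with
    | some r => pure (some r)
    | none => firstT f is

/-- Search for a node among the extensions of the conjunction `K` by at most `k` literals. -/
def searchT {n : ℕ} (S : List (Cube n × Bool)) : ℕ → Conj n → Timed (Option (Conj n × Bool))
  | 0, K => nodeT S K
  | k + 1, K => do
    match ← nodeT S K with
    | some N => pure (some N)
    | none =>
      firstT (fun i => firstT (fun b => searchT S k ((i, b) :: K)) [false, true]) (List.finRange n)

/-- The main loop: if all the remaining examples have the same label `b`, append `(true, b)` and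
stop; otherwise append a node found by the search, and remove the examples that satisfy its
conjunction.  Each round removes an example; the first argument bounds the number of rounds.
(If there is no node, which does not happen for a sample labelled by a `k`-decision list, append
`(true, false)` and stop.) -/
def rivestLoopT (k : ℕ) {n : ℕ} :
    List (Cube n × Bool) → List (Cube n × Bool) → Timed (DecList n)
  | [], _ => do tick; pure [([], false)]
  | _ :: F, S => do
    tick
    if ← allLabelT [] false S then pure [([], false)]
    else if ← allLabelT [] true S then pure [([], true)]
    else
      match ← searchT S k [] with
      | none => pure [([], false)]
      | some N => do
        let S' ← removeT N.1 S
        let L ← rivestLoopT k F S'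
        pure (N :: L)

/-- Rivest's algorithm for `k`-decision lists. -/
def rivestT (k : ℕ) {n : ℕ} (S : List (Cube n × Bool)) : Timed (DecList n) := rivestLoopT k S S

/-- Rivest's algorithm as a learner. -/
def rivest (k : ℕ) : Learner := fun _ _ S => DecList.eval (rivestT k (List.ofFn S)).val

theorem satT_val {n : ℕ} (x : Cube n) (K : Conj n) : (satT x K).val = Conj.sat K x := by
  induction K with
  | nil => rfl
  | cons l K ih =>
    by_cases h : x l.1 = l.2
    · have : Conj.sat (l :: K) x = Conj.sat K x := by simp [Conj.sat, h]
      rw [this, ← ih]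
      simp [satT, bind, h]
    · simp [satT, bind, Conj.sat, h, pure]

/-- The timed evaluation computes the value of the decision list. -/
theorem evalT_val {n : ℕ} (x : Cube n) (L : DecList n) : (evalT x L).val = DecList.eval L x := by
  induction L with
  | nil => rfl
  | cons N L ih =>
    obtain ⟨K, v⟩ := N
    have h := satT_val x K
    by_cases hs : Conj.sat K x = true
    · simp [evalT, bind, DecList.eval, h, hs, pure]
    · simp [evalT, bind, DecList.eval, h, hs, ih]

/-- On samples of `m` examples of dimension `n` Rivest's algorithm makes a number of steps
polynomial in `n` and `m`, and so does the evaluation of the decision list that it returns. -/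
def RivestRunsInPolyTime (k : ℕ) : Prop :=
  ∃ r : MvPolynomial (Fin 2) ℕ, ∀ (n m : ℕ) (S : Fin m → Cube n × Bool),
    (rivestT k (List.ofFn S)).steps ≤ r.eval ![n, m] ∧
    ∀ x, (evalT x (rivestT k (List.ofFn S)).val).steps ≤ r.eval ![n, m]

/-! ### Overriding coordinates of points of the cube -/

/-! Two `k`-decision lists disagree on a union of polynomially many (in `n`) sets defined by `k`-CNF
formulas (`kDL.isUnionOfCNF_ne`). It therefore suffices that a `k`-CNF set of polynomially small
mass has a small neighbourhood of logarithmic radius (`exists_expansion_exponent`). A proper PAC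
learner run with polynomially smaller accuracy is then a robust learner.

The expansion bound goes by induction on `k`. Call the negations of the clauses terms, and let `N`
be of logarithmic size.

If there are `N` satisfiable terms with disjoint variables, a random point satisfies each of them
with probability at least `(2α)⁻ᵏ`, whatever happens on the others. So it usually satisfies many,
and all of these must be destroyed by separate changes to reach the set. An exponential moment makes
this precise (`real_ballAround_le_of_disjoint`).

Otherwise the variables of a maximal disjoint family form a set `I` of at most `kN` variables that
meets every term. Each of the `2 ^ |I|` settings of `I` shortens all terms, and the mass of the
restricted set grows by a factor of at most `(2α) ^ |I|`. Both factors are polynomial, and the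
induction hypothesis applies.

Rivest's algorithm is consistent because the first node of the target list that catches a remaining
example is always available (`exists_validNode`). Consistency and a class whose cardinality has a
polynomial logarithm give the PAC bound. -/

theorem hammingDist_piecewise_le {n : ℕ} (I : Finset (Fin n)) (a x : Cube n) :
    hammingDist x (I.piecewise a x) ≤ I.card := by
  unfold hammingDist
  refine Finset.card_le_card fun i hi => ?_
  by_contra h
  simp [Finset.piecewise, h] at hi

/-- Change the differing coordinates one at a time; each change costs one factor `α`. -/
theorem le_pow_hammingDist_mul {n : ℕ} {α : ℝ} (hα : 0 ≤ α) {w : Cube n → ℝ}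
    (hw : ∀ x y, hammingDist x y = 1 → w x ≤ α * w y) (x y : Cube n) :
    w x ≤ α ^ hammingDist x y * w y := by
  induction h : hammingDist x y generalizing x with
  | zero => simp [hammingDist_eq_zero.1 h]
  | succ d ih =>
    have hne : x ≠ y := by
      rintro rfl
      simp at h
    obtain ⟨i, hi⟩ := Function.ne_iff.1 hne
    have h1 : hammingDist x (Function.update x i (y i)) = 1 := by
      unfold hammingDist
      rw [Finset.card_eq_one]
      refine ⟨i, ?_⟩
      ext j
      by_cases hj : j = i
      · subst hj; simp [hi]
      · simp [hj]
    have h2 : hammingDist (Function.update x i (y i)) y = d := by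
      have : (Finset.univ.filter fun j => (Function.update x i (y i)) j ≠ y j)
          = (Finset.univ.filter fun j => x j ≠ y j).erase i := by
        ext j
        by_cases hj : j = i
        · subst hj; simp
        · simp [hj]
      unfold hammingDist at h ⊢
      rw [this, Finset.card_erase_of_mem (by simp [hi]), h]
      rfl
    calc w x ≤ α * w (Function.update x i (y i)) := hw _ _ h1
      _ ≤ α * (α ^ d * w y) := mul_le_mul_of_nonneg_left (ih _ h2) hα
      _ = α ^ (d + 1) * w y := by ring

/-- Each point has at most `2 ^ |I|` preimages under overriding the coordinates in `I`. -/
theorem sum_piecewise_le {n : ℕ} {f : Cube n → ℝ} (hf : ∀ x, 0 ≤ f x) (I : Finset (Fin n))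
    (a : Cube n) :
    ∑ x, f (I.piecewise a x) ≤ 2 ^ I.card * ∑ y, {y | ∀ i ∈ I, y i = a i}.indicator f y := by
  classical
  rw [Finset.sum_comp f (fun x : Cube n => I.piecewise a x), Finset.mul_sum]
  refine (Finset.sum_le_sum (g := fun y => 2 ^ I.card *
    {y : Cube n | ∀ i ∈ I, y i = a i}.indicator f y) fun y hy => ?_).trans
    (Finset.sum_le_univ_sum_of_nonneg fun y =>
      mul_nonneg (by positivity) (Set.indicator_nonneg (fun x _ => hf x) y))
  obtain ⟨z, -, rfl⟩ := Finset.mem_image.1 hy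
  rw [Set.indicator_of_mem (by intro i hi; simp [Finset.piecewise, hi]), nsmul_eq_mul]
  refine mul_le_mul_of_nonneg_right ?_ (hf _)
  have hcard : (Finset.univ.filter fun x : Cube n => I.piecewise a x = I.piecewise a z).card
      ≤ (Finset.univ : Finset (I → Bool)).card := by
    -- Points of one fibre agree outside `I`, so they are determined by their restriction to `I`.
    refine Finset.card_le_card_of_injOn (fun x i => x i) (fun _ _ => Finset.mem_univ _) ?_
    intro x hx y hy hxy
    have hx' := (Finset.mem_filter.1 hx).2
    have hy' := (Finset.mem_filter.1 hy).2
    funext i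
    by_cases hi : i ∈ I
    · exact congrFun hxy ⟨i, hi⟩
    · simpa [Finset.piecewise, hi] using congrFun (hx'.trans hy'.symm) i
  have : (Finset.univ : Finset (I → Bool)).card = 2 ^ I.card := by simp
  rw [this] at hcard
  exact_mod_cast hcard

theorem pmf_real_eq_sum {n : ℕ} (D : PMF (Cube n)) (A : Set (Cube n)) :
    D.toMeasure.real A = ∑ x, A.indicator (fun x => (D x).toReal) x := by
  rw [measureReal_def, PMF.toMeasure_apply_fintype D (s := A),
    ENNReal.toReal_sum (fun x _ => ?_)]
  · refine Finset.sum_congr rfl fun x _ => ?_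
    by_cases h : x ∈ A <;> simp [h]
  · by_cases h : x ∈ A <;> simp [h, D.apply_ne_top]

theorem IsLogLipschitz.le_pow_mul {n : ℕ} {α : ℝ} (hα : 1 ≤ α) {D : PMF (Cube n)}
    (hD : IsLogLipschitz α D) (x y : Cube n) :
    (D x).toReal ≤ α ^ hammingDist x y * (D y).toReal := by
  refine le_pow_hammingDist_mul (w := fun x => (D x).toReal) (by linarith) (fun x y h => ?_) x y
  have h1 := (abs_le.1 (hD.2 x y h)).2
  have hx := hD.1 x
  have hy := hD.1 y
  rw [← Real.log_le_log_iff hx (by positivity), Real.log_mul (by positivity) hy.ne']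
  linarith

/-- Overriding the coordinates in `I` distorts probabilities by a factor of at most
`(2 α) ^ |I|`. -/
theorem IsLogLipschitz.real_preimage_piecewise_le {n : ℕ} {α : ℝ} (hα : 1 ≤ α) {D : PMF (Cube n)}
    (hD : IsLogLipschitz α D) (I : Finset (Fin n)) (a : Cube n) (A : Set (Cube n)) :
    D.toMeasure.real {x | I.piecewise a x ∈ A} ≤ (2 * α) ^ I.card * D.toMeasure.real A := by
  rw [pmf_real_eq_sum, pmf_real_eq_sum]
  set w : Cube n → ℝ := fun x => (D x).toReal with hwdef
  have hw0 : ∀ x, 0 ≤ w x := fun x => (hD.1 x).le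
  have hA0 : ∀ x, 0 ≤ A.indicator w x := Set.indicator_nonneg fun x _ => hw0 x
  -- The factor `α ^ |I|` is the change of mass from `x` to the overridden point; `2 ^ |I|` is the
  -- size of the fibres.
  calc ∑ x, {x | I.piecewise a x ∈ A}.indicator w x
      ≤ ∑ x, α ^ I.card * A.indicator w (I.piecewise a x) := by
        refine Finset.sum_le_sum fun x _ => ?_
        by_cases h : I.piecewise a x ∈ A
        · rw [Set.indicator_of_mem (by exact h), Set.indicator_of_mem h]
          exact (hD.le_pow_mul hα x _).trans (mul_le_mul_of_nonneg_right
            (pow_le_pow_right₀ hα (hammingDist_piecewise_le I a x)) (hw0 _))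
        · rw [Set.indicator_of_notMem (by exact h), Set.indicator_of_notMem h]
          simp
    _ = α ^ I.card * ∑ x, A.indicator w (I.piecewise a x) := by rw [Finset.mul_sum]
    _ ≤ α ^ I.card * (2 ^ I.card *
          ∑ y, {y | ∀ i ∈ I, y i = a i}.indicator (A.indicator w) y) :=
        mul_le_mul_of_nonneg_left (sum_piecewise_le hA0 I a) (by positivity)
    _ ≤ α ^ I.card * (2 ^ I.card * ∑ y, A.indicator w y) := by
        gcongr with y
        exact Set.indicator_le_self' (fun _ _ => hA0 _) y
    _ = _ := by rw [mul_pow]; ring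

/-! ### Terms and formulas

A formula in conjunctive normal form is given by the set `Φ` of the negations of its clauses: a
point satisfies the formula if it satisfies no term in `Φ`. -/

/-- The variables of a term. -/
def Conj.vars {n : ℕ} (K : Conj n) : Finset (Fin n) := (K.map Prod.fst).toFinset

/-- The points that satisfy none of the terms in `Φ`. -/
def avoiding {n : ℕ} (Φ : Set (Conj n)) : Set (Cube n) := {x | ∀ K ∈ Φ, Conj.sat K x = false}

/-- The points at distance at most `ρ` from a set. -/
def ballAround {n : ℕ} (ρ : ℝ) (A : Set (Cube n)) : Set (Cube n) :=
  {x | ∃ z, (hammingDist x z : ℝ) ≤ ρ ∧ z ∈ A}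

theorem Conj.sat_iff {n : ℕ} {K : Conj n} {x : Cube n} :
    Conj.sat K x = true ↔ ∀ l ∈ K, x l.1 = l.2 := by
  simp [Conj.sat]

theorem Conj.mem_vars {n : ℕ} {K : Conj n} {i : Fin n} :
    i ∈ Conj.vars K ↔ ∃ l ∈ K, l.1 = i := by
  simp [Conj.vars]

theorem Conj.card_vars_le {n : ℕ} (K : Conj n) : (Conj.vars K).card ≤ K.length := by
  simpa [Conj.vars] using List.toFinset_card_le (K.map Prod.fst)

theorem Conj.sat_congr {n : ℕ} {K : Conj n} {x y : Cube n} (h : ∀ i ∈ Conj.vars K, x i = y i) :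
    Conj.sat K x = Conj.sat K y := by
  rw [Bool.eq_iff_iff, Conj.sat_iff, Conj.sat_iff]
  refine forall₂_congr fun l hl => ?_
  rw [h l.1 (Conj.mem_vars.2 ⟨l, hl, rfl⟩)]

/-- If the weight `u` changes by a factor of at most `β` when the variables of a satisfiable term
are overridden, then the points that satisfy the term carry a constant part of the weight. -/
theorem sum_le_mul_sum_sat {n k : ℕ} {β : ℝ} (hβ : 0 ≤ β) {u : Cube n → ℝ} (hu : ∀ x, 0 ≤ u x)
    {K : Conj n} {a : Cube n} (ha : Conj.sat K a = true) (hk : K.length ≤ k)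
    (h : ∀ x, u x ≤ β * u ((Conj.vars K).piecewise a x)) :
    ∑ x, u x ≤ β * 2 ^ k * ∑ x, {x | Conj.sat K x = true}.indicator u x := by
  calc ∑ x, u x ≤ ∑ x, β * u ((Conj.vars K).piecewise a x) := Finset.sum_le_sum fun x _ => h x
    _ = β * ∑ x, u ((Conj.vars K).piecewise a x) := by rw [Finset.mul_sum]
    _ ≤ β * (2 ^ (Conj.vars K).card *
          ∑ y, {y | ∀ i ∈ Conj.vars K, y i = a i}.indicator u y) :=
        mul_le_mul_of_nonneg_left (sum_piecewise_le hu _ a) hβ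
    _ ≤ β * (2 ^ k * ∑ x, {x | Conj.sat K x = true}.indicator u x) := by
        have h0 : ∀ y, 0 ≤ {y | ∀ i ∈ Conj.vars K, y i = a i}.indicator u y :=
          Set.indicator_nonneg fun x _ => hu x
        gcongr with y
        · exact Finset.sum_nonneg fun y _ => h0 y
        · norm_num
        · exact K.card_vars_le.trans hk
        · exact hu _
        · intro hy
          exact (Conj.sat_congr hy).trans ha
    _ = _ := by ring

/-- An exponential moment of the number of satisfied terms, for terms with disjoint variables. -/
theorem sum_half_pow_countP_le {n k : ℕ} {α : ℝ} (hα : 1 ≤ α) {w : Cube n → ℝ}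
    (hw0 : ∀ x, 0 ≤ w x) (hw : ∀ x y, w x ≤ α ^ hammingDist x y * w y) (M : List (Conj n))
    (hM : M.Pairwise fun K K' => Disjoint (Conj.vars K) (Conj.vars K'))
    (hk : ∀ K ∈ M, K.length ≤ k) (hs : ∀ K ∈ M, ∃ a, Conj.sat K a = true) :
    ∑ x, w x * (1 / 2) ^ M.countP (fun K => Conj.sat K x)
      ≤ (1 - ((2 * α) ^ k)⁻¹ / 2) ^ M.length * ∑ x, w x := by
  induction M with
  | nil => simp
  | cons K M ih =>
    obtain ⟨hKM, hM⟩ := List.pairwise_cons.1 hM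
    have ih := ih hM (fun K' h => hk K' (List.mem_cons_of_mem _ h))
      (fun K' h => hs K' (List.mem_cons_of_mem _ h))
    set u : Cube n → ℝ := fun x => w x * (1 / 2) ^ M.countP (fun K => Conj.sat K x) with hu
    have hu0 : ∀ x, 0 ≤ u x := fun x => mul_nonneg (hw0 x) (by positivity)
    obtain ⟨a, ha⟩ := hs K (by simp)
    have hKk := hk K (by simp)
    have hlow : ∑ x, u x ≤ α ^ k * 2 ^ k * ∑ x, {x | Conj.sat K x = true}.indicator u x := by
      refine sum_le_mul_sum_sat (by positivity) hu0 ha hKk fun x => ?_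
      -- The variables of `K` occur in no term of `M`, so overriding them affects `w` but not the
      -- count.
      have hc : M.countP (fun K' => Conj.sat K' ((Conj.vars K).piecewise a x))
          = M.countP (fun K' => Conj.sat K' x) := by
        refine List.countP_congr fun K' hK' => ?_
        rw [Conj.sat_congr (K := K') (y := x)]
        intro i hi
        have : i ∉ Conj.vars K := fun h => Finset.disjoint_left.1 (hKM K' hK') h hi
        simp [Finset.piecewise, this]
      simp only [hu, hc]
      rw [← mul_assoc]
      refine mul_le_mul_of_nonneg_right ?_ (by positivity)
      refine (hw x _).trans (mul_le_mul_of_nonneg_right (pow_le_pow_right₀ hα ?_) (hw0 _))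
      exact (hammingDist_piecewise_le _ a x).trans (K.card_vars_le.trans hKk)
    -- Satisfying `K` halves the summand, so the mass lost is half of the part of `u` on which `K`
    -- holds.
    have hsplit : ∑ x, w x * (1 / 2) ^ (K :: M).countP (fun K => Conj.sat K x)
        = ∑ x, u x - 1 / 2 * ∑ x, {x | Conj.sat K x = true}.indicator u x := by
      rw [Finset.mul_sum, ← Finset.sum_sub_distrib]
      refine Finset.sum_congr rfl fun x _ => ?_
      by_cases h : Conj.sat K x = true
      · rw [Set.indicator_of_mem (by exact h),
          List.countP_cons_of_pos (p := fun K => Conj.sat K x) h, pow_succ]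
        simp only [hu]
        ring
      · rw [Set.indicator_of_notMem (by exact h),
          List.countP_cons_of_neg (p := fun K => Conj.sat K x) h]
        simp [hu]
    have hη : ((2 * α) ^ k)⁻¹ ≤ 1 := inv_le_one_of_one_le₀ (one_le_pow₀ (by linarith))
    have hpos : (0 : ℝ) < (2 * α) ^ k := by positivity
    have hlow' : ((2 * α) ^ k)⁻¹ * ∑ x, u x ≤ ∑ x, {x | Conj.sat K x = true}.indicator u x := by
      rw [inv_mul_le_iff₀ hpos, mul_pow, mul_comm (2 ^ k : ℝ)]
      exact hlow
    calc _ = ∑ x, u x - 1 / 2 * ∑ x, {x | Conj.sat K x = true}.indicator u x := hsplit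
      _ ≤ (1 - ((2 * α) ^ k)⁻¹ / 2) * ∑ x, u x := by linarith
      _ ≤ (1 - ((2 * α) ^ k)⁻¹ / 2) *
            ((1 - ((2 * α) ^ k)⁻¹ / 2) ^ M.length * ∑ x, w x) :=
          mul_le_mul_of_nonneg_left ih (by linarith)
      _ = _ := by rw [List.length_cons, pow_succ]; ring

/-- Falsifying terms with disjoint variables needs a change in each of them. -/
theorem countP_sat_le_hammingDist {n : ℕ} {x z : Cube n} (M : List (Conj n))
    (hM : M.Pairwise fun K K' => Disjoint (Conj.vars K) (Conj.vars K'))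
    (hz : ∀ K ∈ M, Conj.sat K z = false) :
    M.countP (fun K => Conj.sat K x) ≤ hammingDist x z := by
  -- Only differing coordinates among the variables of the terms are counted, so that the one found
  -- in `K` is new in the induction step.
  suffices h : M.countP (fun K => Conj.sat K x)
      ≤ (Finset.univ.filter fun i => (∃ K ∈ M, i ∈ Conj.vars K) ∧ x i ≠ z i).card by
    refine h.trans (Finset.card_le_card fun i hi => ?_)
    simpa using (Finset.mem_filter.1 hi).2.2
  induction M with
  | nil => simp
  | cons K M ih =>
    obtain ⟨hKM, hM⟩ := List.pairwise_cons.1 hM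
    have ih := ih hM (fun K' h => hz K' (List.mem_cons_of_mem _ h))
    have hsub : (Finset.univ.filter fun i => (∃ K ∈ M, i ∈ Conj.vars K) ∧ x i ≠ z i) ⊆
        (Finset.univ.filter fun i => (∃ K' ∈ K :: M, i ∈ Conj.vars K') ∧ x i ≠ z i) := by
      intro i hi
      obtain ⟨-, ⟨K', hK', hi⟩, hne⟩ := Finset.mem_filter.1 hi
      exact Finset.mem_filter.2 ⟨Finset.mem_univ _, ⟨K', List.mem_cons_of_mem _ hK', hi⟩, hne⟩
    by_cases h : Conj.sat K x = true
    · rw [List.countP_cons_of_pos (p := fun K => Conj.sat K x) h]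
      refine Nat.succ_le_of_lt (lt_of_le_of_lt ih (Finset.card_lt_card ?_))
      refine (Finset.ssubset_iff_of_subset hsub).2 ?_
      have : ∃ i ∈ Conj.vars K, x i ≠ z i := by
        by_contra! hc
        have := Conj.sat_congr hc
        rw [h, hz K (by simp)] at this
        cases this
      obtain ⟨i, hi, hne⟩ := this
      refine ⟨i, Finset.mem_filter.2 ⟨Finset.mem_univ _, ⟨K, by simp, hi⟩, hne⟩, fun hc => ?_⟩
      obtain ⟨-, ⟨K', hK', hi'⟩, -⟩ := Finset.mem_filter.1 hc
      exact Finset.disjoint_left.1 (hKM K' hK') hi hi'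
    · rw [List.countP_cons_of_neg (p := fun K => Conj.sat K x) h]
      exact ih.trans (Finset.card_le_card hsub)

/-- Either `Φ` has `N` terms with disjoint variables, or few variables meet all terms of `Φ`. -/
theorem exists_disjoint_or_hitting {n k : ℕ} {Φ : Set (Conj n)} (hk : ∀ K ∈ Φ, K.length ≤ k)
    (N : ℕ) :
    (∃ M : List (Conj n), M.length = N ∧ (∀ K ∈ M, K ∈ Φ) ∧
      M.Pairwise fun K K' => Disjoint (Conj.vars K) (Conj.vars K')) ∨
    ∃ I : Finset (Fin n), I.card ≤ k * N ∧ ∀ K ∈ Φ, ∃ i ∈ Conj.vars K, i ∈ I := by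
  classical
  induction N with
  | zero => exact Or.inl ⟨[], rfl, by simp, List.Pairwise.nil⟩
  | succ N ih =>
    rcases ih with ⟨M, rfl, hM, hp⟩ | ⟨I, hI, hI'⟩
    · by_cases h : ∀ K ∈ Φ, ∃ i ∈ Conj.vars K, i ∈ M.toFinset.biUnion Conj.vars
      · refine Or.inr ⟨_, ?_, h⟩
        have h1 := Finset.card_biUnion_le_card_mul M.toFinset Conj.vars k fun K hK =>
          K.card_vars_le.trans (hk K (hM K (List.mem_toFinset.1 hK)))
        have h2 := Nat.mul_le_mul_right k (List.toFinset_card_le M)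
        nlinarith
      · push Not at h
        obtain ⟨K, hK, hd⟩ := h
        refine Or.inl ⟨K :: M, rfl, ?_, List.pairwise_cons.2 ⟨fun K' hK' => ?_, hp⟩⟩
        · rintro K' (_ | ⟨_, hK'⟩)
          exacts [hK, hM _ hK']
        · refine Finset.disjoint_left.2 fun i hi hi' => hd i hi ?_
          exact Finset.mem_biUnion.2 ⟨K', List.mem_toFinset.2 hK', hi'⟩
    · exact Or.inr ⟨I, hI.trans (Nat.mul_le_mul_left k N.le_succ), hI'⟩

/-- Few points are close to a point that avoids many terms with disjoint variables. -/
theorem real_ballAround_le_of_disjoint {n k : ℕ} {α : ℝ} (hα : 1 ≤ α) {D : PMF (Cube n)}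
    (hD : IsLogLipschitz α D) {Φ : Set (Conj n)} {M : List (Conj n)} (hMΦ : ∀ K ∈ M, K ∈ Φ)
    (hM : M.Pairwise fun K K' => Disjoint (Conj.vars K) (Conj.vars K'))
    (hk : ∀ K ∈ M, K.length ≤ k) (hs : ∀ K ∈ M, ∃ a, Conj.sat K a = true) (ρ : ℝ) :
    D.toMeasure.real (ballAround ρ (avoiding Φ))
      ≤ (1 - ((2 * α) ^ k)⁻¹ / 2) ^ M.length * 2 ^ ρ := by
  have hw0 : ∀ x, 0 ≤ (D x).toReal := fun x => (hD.1 x).le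
  have h1 := sum_half_pow_countP_le hα hw0 (hD.le_pow_mul hα) M hM hk hs
  have htot : ∑ x, (D x).toReal = 1 := by
    have := pmf_real_eq_sum D Set.univ
    simpa using this.symm
  rw [htot, mul_one] at h1
  refine le_trans ?_ (mul_le_mul_of_nonneg_right h1 (by positivity))
  rw [pmf_real_eq_sum, Finset.sum_mul]
  refine Finset.sum_le_sum fun x _ => Set.indicator_le' (g := fun x => (D x).toReal *
    (1 / 2) ^ (M.countP fun K => Conj.sat K x) * 2 ^ ρ) (fun y hy => ?_) (fun y _ => ?_) x
  · obtain ⟨z, hz, hzΦ⟩ := hy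
    have hc : ((M.countP fun K => Conj.sat K y : ℕ) : ℝ) ≤ ρ :=
      le_trans (by exact_mod_cast countP_sat_le_hammingDist M hM fun K hK => hzΦ K (hMΦ K hK)) hz
    -- Markov's inequality in pointwise form: on the neighbourhood the count is at most `ρ`.
    have h2 : (1 : ℝ) ≤ (1 / 2) ^ (M.countP fun K => Conj.sat K y) * 2 ^ ρ := by
      rw [one_div, inv_pow, ← Real.rpow_natCast, inv_mul_eq_div, one_le_div (by positivity)]
      exact Real.rpow_le_rpow_of_exponent_le (by norm_num) hc
    rw [mul_assoc]
    exact le_mul_of_one_le_right (hw0 y) h2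
  · have := hw0 y
    positivity

/-! ### Expansion of small `k`-CNF sets: restrictions and the induction on the width -/

theorem exists_pow_thresholds {q : ℝ} (hq0 : 0 < q) (hq1 : q < 1) (c : ℕ) {β : ℝ} (hβ : 1 ≤ β) :
    ∃ e : ℕ, ∀ Y : ℝ, 2 ≤ Y → ∃ N : ℕ, q ^ N * Y ^ c ≤ Y⁻¹ ∧ β ^ N ≤ Y ^ e := by
  have hlq : 0 < -Real.log q := by linarith [Real.log_neg hq0 hq1]
  have hlβ : 0 ≤ Real.log β := Real.log_nonneg hβ
  -- With `N` about `B log Y` the power `q ^ N` falls below `Y ^ (-(c + 1))`, while `β ^ N` stays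
  -- polynomial in `Y`.
  set B : ℝ := (c + 1) / (-Real.log q) with hB
  have hB0 : 0 ≤ B := by positivity
  -- The summand 2 absorbs the rounding of `N`, since `1 ≤ 2 log Y` for `Y ≥ 2`.
  refine ⟨⌈(B + 2) * Real.log β⌉₊, fun Y hY => ⟨⌈B * Real.log Y⌉₊, ?_, ?_⟩⟩
  · have hY0 : 0 < Y := by linarith
    have hN := Nat.le_ceil (B * Real.log Y)
    set N := ⌈B * Real.log Y⌉₊
    rw [← Real.log_le_log_iff (by positivity) (by positivity), Real.log_mul (by positivity)
      (by positivity), Real.log_pow, Real.log_pow, Real.log_inv]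
    have h1 : (c + 1) * Real.log Y = B * Real.log Y * (-Real.log q) := by
      rw [mul_right_comm, hB, div_mul_cancel₀ _ hlq.ne']
    have h2 := mul_le_mul_of_nonneg_right hN hlq.le
    linarith
  · have hY0 : 0 < Y := by linarith
    have hlY : 1 / 2 ≤ Real.log Y := by
      have := Real.log_two_gt_d9
      have := Real.log_le_log (by norm_num) hY
      linarith
    have hN := (Nat.ceil_lt_add_one (mul_nonneg hB0 (by linarith : 0 ≤ Real.log Y))).le
    set N := ⌈B * Real.log Y⌉₊
    have he := Nat.le_ceil ((B + 2) * Real.log β)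
    set e := ⌈(B + 2) * Real.log β⌉₊
    rw [← Real.log_le_log_iff (by positivity) (by positivity), Real.log_pow, Real.log_pow]
    calc (N : ℝ) * Real.log β ≤ ((B + 2) * Real.log Y) * Real.log β :=
          mul_le_mul_of_nonneg_right (by linarith) hlβ
      _ = ((B + 2) * Real.log β) * Real.log Y := by ring
      _ ≤ e * Real.log Y := mul_le_mul_of_nonneg_right he (by linarith)

/-- The terms of `Φ` that remain to be avoided after the variables in `I` are set as in `a`. -/
def restrictTerms {n : ℕ} (I : Finset (Fin n)) (a : Cube n) (Φ : Set (Conj n)) : Set (Conj n) :=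
  {K' | ∃ K ∈ Φ, (∀ l ∈ K, l.1 ∈ I → a l.1 = l.2) ∧ K' = K.filter fun l => l.1 ∉ I}

/-- Seeing the restricted set as a preimage under overriding avoids conditioning: the distribution
stays `D`, and `real_preimage_piecewise_le` bounds the mass. -/
theorem avoiding_restrictTerms {n : ℕ} (I : Finset (Fin n)) (a : Cube n) (Φ : Set (Conj n)) :
    avoiding (restrictTerms I a Φ) = {x | I.piecewise a x ∈ avoiding Φ} := by
  ext x
  simp only [avoiding, restrictTerms, Set.mem_ofPred_eq]
  constructor
  · intro h K hK
    by_contra hc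
    rw [Bool.not_eq_false, Conj.sat_iff] at hc
    have h1 := h _ ⟨K, hK, fun l hl hI => by simpa [Finset.piecewise, hI] using hc l hl, rfl⟩
    rw [← Bool.not_eq_true, Conj.sat_iff] at h1
    refine h1 fun l hl => ?_
    rw [List.mem_filter] at hl
    have hI : l.1 ∉ I := by simpa using hl.2
    simpa [Finset.piecewise, hI] using hc l hl.1
  · rintro h _ ⟨K, hK, hc, rfl⟩
    have h1 := h K hK
    rw [← Bool.not_eq_true, Conj.sat_iff] at h1 ⊢
    refine fun h2 => h1 fun l hl => ?_
    by_cases hI : l.1 ∈ I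
    · simpa [Finset.piecewise, hI] using hc l hl hI
    · simpa [Finset.piecewise, hI] using h2 l (List.mem_filter.2 ⟨hl, by simpa using hI⟩)

/-- Every term loses the literals over `I`, of which it has at least one. This is the descent of the
induction on the width. -/
theorem length_le_of_mem_restrictTerms {n k : ℕ} {I : Finset (Fin n)} {a : Cube n}
    {Φ : Set (Conj n)} (hk : ∀ K ∈ Φ, K.length ≤ k + 1)
    (hI : ∀ K ∈ Φ, ∃ i ∈ Conj.vars K, i ∈ I) :
    ∀ K ∈ restrictTerms I a Φ, K.length ≤ k := by
  rintro _ ⟨K, hK, -, rfl⟩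
  obtain ⟨i, hi, hiI⟩ := hI K hK
  obtain ⟨l, hl, rfl⟩ := Conj.mem_vars.1 hi
  have : (K.filter fun l => l.1 ∉ I).length < K.length :=
    List.length_filter_lt_length_iff_exists.2 ⟨l, hl, by simpa using hiI⟩
  have := hk K hK
  omega

/-- A nearby point `z` that avoids `Φ` also avoids the restriction of `Φ` given by its own values on
`I`. -/
theorem ballAround_avoiding_subset {n : ℕ} (ρ : ℝ) (I : Finset (Fin n)) (Φ : Set (Conj n)) :
    ballAround ρ (avoiding Φ) ⊆ ⋃ a : I → Bool, ballAround ρ (avoiding (restrictTerms I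
      (fun i => if h : i ∈ I then a ⟨i, h⟩ else false) Φ)) := by
  rintro x ⟨z, hz, hzΦ⟩
  refine Set.mem_iUnion.2 ⟨fun i => z i, z, hz, ?_⟩
  rw [avoiding_restrictTerms, Set.mem_ofPred_eq]
  convert hzΦ
  ext i
  by_cases hi : i ∈ I <;> simp [Finset.piecewise, hi]

/-- Allows the terms to be assumed satisfiable, as the exponential moment bound requires. -/
theorem avoiding_satisfiable {n : ℕ} (Φ : Set (Conj n)) :
    avoiding {K ∈ Φ | ∃ a, Conj.sat K a = true} = avoiding Φ := by
  ext x
  refine ⟨fun h K hK => ?_, fun h K hK => h K hK.1⟩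
  by_contra hc
  rw [Bool.not_eq_false] at hc
  rw [h K ⟨hK, x, hc⟩] at hc
  cases hc

/-- Under log-Lipschitz distributions a set defined by a `k`-CNF formula of polynomially small
probability has a small neighbourhood of logarithmic radius. -/
theorem exists_expansion_exponent {α : ℝ} (hα : 1 ≤ α) (k c : ℕ) :
    ∃ d : ℕ, ∀ Y : ℝ, 2 ≤ Y → ∀ ρ : ℝ, (2 : ℝ) ^ ρ ≤ Y ^ c →
      ∀ (n : ℕ) (D : PMF (Cube n)), IsLogLipschitz α D →
      ∀ Φ : Set (Conj n), (∀ K ∈ Φ, K.length ≤ k) →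
      D.toMeasure.real (avoiding Φ) < (Y ^ d)⁻¹ →
      D.toMeasure.real (ballAround ρ (avoiding Φ)) ≤ Y⁻¹ := by
  induction k with
  | zero =>
    -- With `d = 0` the hypothesis says that the mass is below 1. This excludes an empty `Φ`, and
    -- the empty term is avoided by no point.
    refine ⟨0, fun Y hY ρ _ n D hD Φ hk hlt => ?_⟩
    by_cases h : ([] : Conj n) ∈ Φ
    · have : ballAround ρ (avoiding Φ) = ∅ := by
        ext x
        simp only [ballAround, Set.mem_ofPred_eq, Set.mem_empty_iff_false, iff_false]
        rintro ⟨z, -, hz⟩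
        have := hz _ h
        simp [Conj.sat] at this
      rw [this, measureReal_empty]
      positivity
    · have : avoiding Φ = Set.univ := by
        refine Set.eq_univ_of_forall fun x K hK => absurd hK ?_
        rwa [List.eq_nil_of_length_eq_zero (Nat.le_zero.1 (hk K hK))]
      rw [this] at hlt
      simp at hlt
  | succ k ih =>
    obtain ⟨d, hd⟩ := ih
    have h2α : 1 ≤ 2 * α := by linarith
    have hη1 : ((2 * α) ^ (k + 1))⁻¹ ≤ 1 := inv_le_one_of_one_le₀ (one_le_pow₀ h2α)
    have hη0 : 0 < ((2 * α) ^ (k + 1))⁻¹ := by positivity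
    obtain ⟨e, he⟩ := exists_pow_thresholds (q := 1 - ((2 * α) ^ (k + 1))⁻¹ / 2)
      (by linarith) (by linarith) c (one_le_pow₀ h2α : 1 ≤ (2 * α) ^ (k + 1))
    -- The induction hypothesis is used with `Y ^ (e + 1)`, whose threshold is `Y ^ ((e + 1) * d)`:
    -- its conclusion leaves `Y⁻¹` after the sum over the settings of `I`. The other `Y ^ e` pays
    -- for the distortion `(2α) ^ |I|`.
    refine ⟨e + (e + 1) * d, fun Y hY ρ hρ n D hD Φ hk hlt => ?_⟩
    obtain ⟨N, hN, hNe⟩ := he Y hY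
    rw [← avoiding_satisfiable] at hlt ⊢
    set Ψ : Set (Conj n) := {K ∈ Φ | ∃ a, Conj.sat K a = true} with hΨ
    have hΨk : ∀ K ∈ Ψ, K.length ≤ k + 1 := fun K hK => hk K hK.1
    have hY0 : 0 < Y := by linarith
    rcases exists_disjoint_or_hitting hΨk N with ⟨M, rfl, hMΨ, hM⟩ | ⟨I, hI, hIΨ⟩
    · refine (real_ballAround_le_of_disjoint hα hD hMΨ hM (fun K hK => hΨk K (hMΨ K hK))
        (fun K hK => (hMΨ K hK).2) ρ).trans (le_trans ?_ hN)
      exact mul_le_mul_of_nonneg_left hρ (pow_nonneg (by linarith) _)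
    · have hIe : (2 * α) ^ I.card ≤ Y ^ e := by
        refine le_trans (pow_le_pow_right₀ h2α hI) ?_
        rwa [pow_mul]
      have hbound : ∀ a : Cube n,
          D.toMeasure.real (ballAround ρ (avoiding (restrictTerms I a Ψ)))
            ≤ (Y ^ (e + 1))⁻¹ := by
        intro a
        refine hd (Y ^ (e + 1)) ?_ ρ ?_ n D hD _ (length_le_of_mem_restrictTerms hΨk hIΨ) ?_
        · exact hY.trans (le_self_pow₀ (by linarith) (by omega))
        · refine hρ.trans (pow_le_pow_left₀ hY0.le ?_ c)
          exact le_self_pow₀ (by linarith) (by omega)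
        · rw [avoiding_restrictTerms]
          refine (hD.real_preimage_piecewise_le hα I a _).trans_lt ?_
          calc (2 * α) ^ I.card * D.toMeasure.real (avoiding Ψ)
              ≤ Y ^ e * D.toMeasure.real (avoiding Ψ) :=
                mul_le_mul_of_nonneg_right hIe measureReal_nonneg
            _ < Y ^ e * (Y ^ (e + (e + 1) * d))⁻¹ :=
                mul_lt_mul_of_pos_left hlt (by positivity)
            _ = ((Y ^ (e + 1)) ^ d)⁻¹ := by
                rw [pow_add, ← pow_mul]
                field_simp
      calc D.toMeasure.real (ballAround ρ (avoiding Ψ))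
          ≤ ∑ a : I → Bool, D.toMeasure.real (ballAround ρ (avoiding (restrictTerms I
              (fun i => if h : i ∈ I then a ⟨i, h⟩ else false) Ψ))) :=
            (measureReal_mono (ballAround_avoiding_subset ρ I Ψ)).trans
              (measureReal_iUnion_fintype_le _)
        _ ≤ ∑ _a : I → Bool, (Y ^ (e + 1))⁻¹ := Finset.sum_le_sum fun a _ => hbound _
        _ = 2 ^ I.card * (Y ^ (e + 1))⁻¹ := by simp
        _ ≤ Y ^ e * (Y ^ (e + 1))⁻¹ := by
            refine mul_le_mul_of_nonneg_right (le_trans ?_ hIe) (by positivity)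
            exact pow_le_pow_left₀ (by norm_num) (by linarith) _
        _ = Y⁻¹ := by rw [pow_succ]; field_simp

/-! ### Short representations of decision lists -/

/-- Padding with `none` encodes bounded lists by functions on `Fin k`; this counts both terms and
decision lists. -/
theorem exists_ofFn_reduceOption {β : Type*} (k : ℕ) (L : List β) (h : L.length ≤ k) :
    ∃ g : Fin k → Option β, (List.ofFn g).reduceOption = L ∧ ∀ i, ∀ a ∈ g i, a ∈ L := by
  induction k generalizing L with
  | zero => exact ⟨Fin.elim0, by simp [List.eq_nil_of_length_eq_zero (Nat.le_zero.1 h)],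
      fun i => i.elim0⟩
  | succ k ih =>
    cases L with
    | nil =>
      obtain ⟨g, hg, hm⟩ := ih [] (by simp)
      refine ⟨Fin.cons none g, by simpa [List.ofFn_succ] using hg, fun i => ?_⟩
      refine Fin.cases (by simp) (fun j => ?_) i
      simpa using hm j
    | cons b L =>
      obtain ⟨g, hg, hm⟩ := ih L (by simpa using h)
      refine ⟨Fin.cons (some b) g, by simpa [List.ofFn_succ] using hg, fun i => ?_⟩
      refine Fin.cases (by simp) (fun j a ha => ?_) i
      exact List.mem_cons_of_mem _ (hm j a (by simpa using ha))

/-- The terms with at most `k` literals. -/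
def boundedConjs (n k : ℕ) : Finset (Conj n) :=
  Finset.univ.image fun g : Fin k → Option (Literal n) => (List.ofFn g).reduceOption

theorem mem_boundedConjs {n k : ℕ} {K : Conj n} (h : K.length ≤ k) : K ∈ boundedConjs n k := by
  obtain ⟨g, hg, -⟩ := exists_ofFn_reduceOption k K h
  exact Finset.mem_image.2 ⟨g, Finset.mem_univ _, hg⟩

theorem card_boundedConjs_le (n k : ℕ) : (boundedConjs n k).card ≤ (2 * n + 1) ^ k := by
  refine Finset.card_image_le.trans ?_
  simp [mul_comm]

/-- Remove the nodes whose conjunction occurs earlier in the list. -/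
def DecList.dedupConjs {n : ℕ} : DecList n → DecList n
  | [] => []
  | N :: L => N :: (DecList.dedupConjs L).filter fun N' => N'.1 ≠ N.1

theorem DecList.eval_filter_ne {n : ℕ} {K : Conj n} {x : Cube n} (hK : Conj.sat K x = false)
    (L : DecList n) : DecList.eval (L.filter fun N => N.1 ≠ K) x = DecList.eval L x := by
  induction L with
  | nil => rfl
  | cons N L ih =>
    obtain ⟨K', v⟩ := N
    by_cases h : K' = K
    · subst h
      rw [List.filter_cons_of_neg (by simp), ih]
      simp [DecList.eval, hK]
    · rw [List.filter_cons_of_pos (by simpa using h)]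
      simp only [DecList.eval, ih]

theorem DecList.eval_dedupConjs {n : ℕ} (L : DecList n) (x : Cube n) :
    DecList.eval (DecList.dedupConjs L) x = DecList.eval L x := by
  induction L with
  | nil => rfl
  | cons N L ih =>
    obtain ⟨K, v⟩ := N
    simp only [DecList.dedupConjs, DecList.eval]
    by_cases h : Conj.sat K x = true
    · simp [h]
    · rw [DecList.eval_filter_ne (by simpa using h), ih]

theorem DecList.dedupConjs_subset {n : ℕ} (L : DecList n) : DecList.dedupConjs L ⊆ L := by
  induction L with
  | nil => exact List.Subset.refl _
  | cons N L ih =>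
    exact List.cons_subset_cons _ fun _ h => ih (List.mem_of_mem_filter h)

theorem DecList.nodup_dedupConjs {n : ℕ} (L : DecList n) :
    ((DecList.dedupConjs L).map Prod.fst).Nodup := by
  induction L with
  | nil => exact List.nodup_nil
  | cons N L ih =>
    refine List.nodup_cons.2 ⟨by simp, ?_⟩
    exact ih.sublist (List.filter_sublist.map _)

/-- A node whose conjunction occurs earlier never decides a value, so distinct conjunctions suffice.
The final node `true` may be lost in this way, hence only the bound on the lengths of the
conjunctions is kept. -/
theorem DecList.exists_short {n k : ℕ} (L : DecList n) (hL : ∀ N ∈ L, N.1.length ≤ k) :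
    ∃ L' : DecList n, (∀ N ∈ L', N.1.length ≤ k) ∧ L'.length ≤ (2 * n + 1) ^ k ∧
      ∀ x, DecList.eval L' x = DecList.eval L x := by
  refine ⟨DecList.dedupConjs L, fun N hN => hL N (L.dedupConjs_subset hN), ?_, L.eval_dedupConjs⟩
  rw [← List.length_map (f := Prod.fst), ← List.toFinset_card_of_nodup L.nodup_dedupConjs]
  refine (Finset.card_le_card fun K hK => ?_).trans (card_boundedConjs_le n k)
  obtain ⟨N, hN, rfl⟩ := List.mem_map.1 (List.mem_toFinset.1 hK)
  exact mem_boundedConjs (hL N (L.dedupConjs_subset hN))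

theorem kDL.exists_short {n k : ℕ} {f : Cube n → Bool} (hf : f ∈ kDL k n) :
    ∃ L : DecList n, (∀ N ∈ L, N.1.length ≤ k) ∧ L.length ≤ (2 * n + 1) ^ k ∧
      f = L.eval := by
  obtain ⟨L, hL, hfL⟩ := hf
  obtain ⟨L', h1, h2, h3⟩ := L.exists_short hL.1
  exact ⟨L', h1, h2, funext fun x => (hfL x).trans (h3 x).symm⟩

/-- A short list fills `(2n + 1) ^ k` slots, each empty or holding a term and a bit. -/
theorem kDL.exists_finset (n k : ℕ) : ∃ H : Finset (Cube n → Bool), kDL k n ⊆ H ∧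
    H.card ≤ (2 * (2 * n + 1) ^ k + 1) ^ (2 * n + 1) ^ k := by
  classical
  refine ⟨(Fintype.piFinset fun _ : Fin ((2 * n + 1) ^ k) =>
    (boundedConjs n k ×ˢ (Finset.univ : Finset Bool)).insertNone).image
      fun g => DecList.eval (List.ofFn g).reduceOption, fun f hf => ?_, ?_⟩
  · obtain ⟨L, hL, hlen, rfl⟩ := kDL.exists_short hf
    obtain ⟨g, hg, hm⟩ := exists_ofFn_reduceOption _ L hlen
    refine Finset.mem_coe.2 (Finset.mem_image.2 ⟨g, Fintype.mem_piFinset.2 fun i => ?_, ?_⟩)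
    · refine Finset.mem_insertNone.2 fun N hN => Finset.mem_product.2 ⟨?_, Finset.mem_univ _⟩
      exact mem_boundedConjs (hL N (hm i N hN))
    · rw [hg]
  · refine Finset.card_image_le.trans ?_
    rw [Fintype.card_piFinset_const, Finset.card_insertNone, Finset.card_product]
    refine Nat.pow_le_pow_left ?_ _
    have := card_boundedConjs_le n k
    simp only [Finset.card_univ, Fintype.card_bool]
    omega

/-! ### Circuits for decision lists -/

/-- Gate addresses are relative, so gates can be stacked on `C` without changing its values; the
length of `vs` records where those values begin. -/
theorem exists_circuit_sat {n : ℕ} (C : List (Gate n)) (K : Conj n) :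
    ∃ C' : List (Gate n), C'.length ≤ 3 * K.length + 1 ∧ ∀ x, ∃ vs : List Bool,
      vs.length + 1 = C'.length ∧
      circuitValues x (C' ++ C) = Conj.sat K x :: (vs ++ circuitValues x C) := by
  induction K with
  | nil => exact ⟨[.const true], by simp, fun x => ⟨[], rfl, rfl⟩⟩
  | cons l K ih =>
    obtain ⟨C', hC', h⟩ := ih
    obtain ⟨i, b⟩ := l
    cases b
    · refine ⟨.and 0 2 :: .not 0 :: .input i :: C', by simp; omega, fun x => ?_⟩
      obtain ⟨vs, hvs, h⟩ := h x
      refine ⟨(!(x i)) :: x i :: Conj.sat K x :: vs, by simp [hvs], ?_⟩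
      simp [circuitValues, h, Gate.eval, Conj.sat]
    · refine ⟨.and 0 1 :: .input i :: C', by simp; omega, fun x => ?_⟩
      obtain ⟨vs, hvs, h⟩ := h x
      refine ⟨x i :: Conj.sat K x :: vs, by simp [hvs], ?_⟩
      simp [circuitValues, h, Gate.eval, Conj.sat]

theorem DecList.exists_circuit {n k : ℕ} (L : DecList n) (hL : ∀ N ∈ L, N.1.length ≤ k) :
    ∃ C : List (Gate n), C.length ≤ L.length * (3 * k + 3) + 1 ∧ ∀ x, ∃ vs : List Bool,
      circuitValues x C = DecList.eval L x :: vs := by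
  induction L with
  | nil => exact ⟨[.const false], by simp, fun x => ⟨[], rfl⟩⟩
  | cons N L ih =>
    obtain ⟨C, hC, h⟩ := ih fun N hN => hL N (List.mem_cons_of_mem _ hN)
    obtain ⟨K, v⟩ := N
    obtain ⟨C', hC', h'⟩ := exists_circuit_sat C K
    have hK : K.length ≤ k := hL (K, v) (by simp)
    have hlen : ((K, v) :: L).length * (3 * k + 3) = L.length * (3 * k + 3) + (3 * k + 3) := by
      simp only [List.length_cons]; ring
    cases v
    · refine ⟨.and 0 (C'.length + 1) :: .not 0 :: (C' ++ C), ?_, fun x => ?_⟩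
      · rw [hlen]; simp; omega
      · obtain ⟨vs, h⟩ := h x
        obtain ⟨vs', hvs', h'⟩ := h' x
        refine ⟨(!Conj.sat K x) :: Conj.sat K x :: (vs' ++ DecList.eval L x :: vs), ?_⟩
        rw [circuitValues, circuitValues, h', h, ← hvs']
        simp only [Gate.eval, DecList.eval]
        cases Conj.sat K x <;> simp
    · refine ⟨.or 0 C'.length :: (C' ++ C), ?_, fun x => ?_⟩
      · rw [hlen]; simp; omega
      · obtain ⟨vs, h⟩ := h x
        obtain ⟨vs', hvs', h'⟩ := h' x
        refine ⟨Conj.sat K x :: (vs' ++ DecList.eval L x :: vs), ?_⟩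
        rw [circuitValues, h', h, ← hvs']
        simp only [Gate.eval, DecList.eval]
        cases Conj.sat K x <;> simp

theorem kDL.hasCircuitOfSize {n k : ℕ} {f : Cube n → Bool} (hf : f ∈ kDL k n) :
    HasCircuitOfSize f ((2 * (n : ℝ) + 1) ^ k * (3 * k + 3) + 1) := by
  obtain ⟨L, hL, hlen, rfl⟩ := kDL.exists_short hf
  obtain ⟨C, hC, h⟩ := L.exists_circuit hL
  refine ⟨C, ?_, fun x => ?_⟩
  · have := hC.trans (Nat.add_le_add_right (Nat.mul_le_mul_right (3 * k + 3) hlen) 1)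
    exact_mod_cast this
  · obtain ⟨vs, h⟩ := h x
    rw [h]
    rfl

/-! ### The disagreement of two decision lists -/

/-- `A` is the union of at most `t` sets defined by `k`-CNF formulas. -/
def IsUnionOfCNF {n : ℕ} (k t : ℕ) (A : Set (Cube n)) : Prop :=
  ∃ F : List (Set (Conj n)), F.length ≤ t ∧ (∀ Φ ∈ F, ∀ K ∈ Φ, K.length ≤ k) ∧
    A = {x | ∃ Φ ∈ F, x ∈ avoiding Φ}

namespace IsUnionOfCNF

variable {n k s t : ℕ} {A B : Set (Cube n)}

theorem mono (hA : IsUnionOfCNF k s A) (h : s ≤ t) : IsUnionOfCNF k t A := by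
  obtain ⟨F, hF, h1, h2⟩ := hA
  exact ⟨F, hF.trans h, h1, h2⟩

theorem avoiding {Φ : Set (Conj n)} (hΦ : ∀ K ∈ Φ, K.length ≤ k) :
    IsUnionOfCNF k 1 (avoiding Φ) :=
  ⟨[Φ], by simp, by simpa using hΦ, by simp⟩

theorem empty : IsUnionOfCNF k 0 (∅ : Set (Cube n)) := ⟨[], by simp, by simp, by simp⟩

theorem union (hA : IsUnionOfCNF k s A) (hB : IsUnionOfCNF k t B) :
    IsUnionOfCNF k (s + t) (A ∪ B) := by
  obtain ⟨F, hF, hFk, rfl⟩ := hA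
  obtain ⟨G, hG, hGk, rfl⟩ := hB
  refine ⟨F ++ G, by simpa using Nat.add_le_add hF hG, fun Φ hΦ => ?_, ?_⟩
  · rcases List.mem_append.1 hΦ with h | h
    exacts [hFk Φ h, hGk Φ h]
  · ext x
    simp [or_and_right, exists_or]

/-- Intersection distributes over the pieces of `A`; the hypothesis on `B` has the form that
`isUnionOfCNF_eval` supplies. -/
theorem inter (hA : IsUnionOfCNF k s A)
    (hB : ∀ Φ : Set (Conj n), (∀ K ∈ Φ, K.length ≤ k) → IsUnionOfCNF k t (_root_.avoiding Φ ∩ B)) :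
    IsUnionOfCNF k (s * t) (A ∩ B) := by
  obtain ⟨F, hF, hFk, rfl⟩ := hA
  refine mono (s := F.length * t) ?_ (Nat.mul_le_mul_right t hF)
  clear hF
  induction F with
  | nil => simpa using empty.mono (Nat.zero_le _)
  | cons Φ F ih =>
    have h := (hB Φ (hFk Φ (by simp))).union (ih fun Ψ h => hFk Ψ (List.mem_cons_of_mem _ h))
    refine (congrArg (IsUnionOfCNF k _) ?_).mp (h.mono (by rw [List.length_cons]; linarith))
    ext x
    simp only [Set.mem_union, Set.mem_inter_iff, Set.mem_ofPred_eq, List.mem_cons,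
      or_and_right, exists_or, exists_eq_left]

end IsUnionOfCNF

/-- Peel off the first node. If its term fails, it joins `Φ` and the tail decides; if it holds, the
value is settled and contributes at most one more piece. Carrying `Φ` along makes the induction
work. -/
theorem isUnionOfCNF_eval {n k : ℕ} (hk : 1 ≤ k) (v : Bool) (L : DecList n)
    (hL : ∀ N ∈ L, N.1.length ≤ k) (Φ : Set (Conj n)) (hΦ : ∀ K ∈ Φ, K.length ≤ k) :
    IsUnionOfCNF k (L.length + 1) (avoiding Φ ∩ {x | DecList.eval L x = v}) := by
  induction L generalizing Φ with
  | nil =>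
    cases v
    · simpa [DecList.eval] using IsUnionOfCNF.avoiding hΦ
    · simpa [DecList.eval] using IsUnionOfCNF.empty.mono (Nat.zero_le 1)
  | cons N L ih =>
    obtain ⟨K, u⟩ := N
    have hK : K.length ≤ k := hL (K, u) (by simp)
    have h1 := ih (fun N hN => hL N (List.mem_cons_of_mem _ hN)) (insert K Φ) (by
      rintro K' (rfl | h)
      exacts [hK, hΦ K' h])
    -- That `K` holds is a conjunction of unit clauses, which is where `1 ≤ k` is needed.
    have h2 : IsUnionOfCNF k 1 (avoiding (Φ ∪ {K' | ∃ l ∈ K, K' = [(l.1, !l.2)]})) := by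
      refine IsUnionOfCNF.avoiding ?_
      rintro K' (h | ⟨l, -, rfl⟩)
      exacts [hΦ K' h, by simpa using hk]
    have e1 : ∀ x, x ∈ avoiding (insert K Φ) ↔ x ∈ avoiding Φ ∧ Conj.sat K x = false := by
      intro x
      simp [avoiding, and_comm]
    have e2 : ∀ x, x ∈ avoiding (Φ ∪ {K' | ∃ l ∈ K, K' = [(l.1, !l.2)]}) ↔
        x ∈ avoiding Φ ∧ Conj.sat K x = true := by
      intro x
      rw [Conj.sat_iff]
      constructor
      · refine fun h => ⟨fun K' hK' => h K' (Or.inl hK'), fun l hl => ?_⟩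
        simpa [Conj.sat] using h _ (Or.inr ⟨l, hl, rfl⟩)
      · rintro ⟨h, h'⟩ K' (hK' | ⟨l, hl, rfl⟩)
        · exact h K' hK'
        · simpa [Conj.sat] using h' l hl
    by_cases huv : u = v
    · refine (congrArg (IsUnionOfCNF k _) ?_).mp ((h1.union h2).mono (by simp))
      ext x
      simp only [Set.mem_union, Set.mem_inter_iff, e1, e2, Set.mem_ofPred_eq, DecList.eval]
      cases Conj.sat K x <;> simp [huv]
    · refine (congrArg (IsUnionOfCNF k _) ?_).mp (h1.mono (by simp))
      ext x
      simp only [Set.mem_inter_iff, e1, Set.mem_ofPred_eq, DecList.eval]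
      cases Conj.sat K x <;> simp [huv]

theorem kDL.isUnionOfCNF_ne {n k : ℕ} (hk : 1 ≤ k) {f g : Cube n → Bool} (hf : f ∈ kDL k n)
    (hg : g ∈ kDL k n) :
    IsUnionOfCNF k (2 * ((2 * n + 1) ^ k + 1) ^ 2) {x | f x ≠ g x} := by
  obtain ⟨L, hL, hlen, rfl⟩ := kDL.exists_short hf
  obtain ⟨L', hL', hlen', rfl⟩ := kDL.exists_short hg
  have h : ∀ v, IsUnionOfCNF k (((2 * n + 1) ^ k + 1) * ((2 * n + 1) ^ k + 1))
      ({x | L.eval x = v} ∩ {x | L'.eval x = !v}) := by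
    intro v
    refine IsUnionOfCNF.inter ?_ fun Φ hΦ =>
      (isUnionOfCNF_eval hk _ L' hL' Φ hΦ).mono (Nat.add_le_add_right hlen' 1)
    have := (isUnionOfCNF_eval hk v L hL ∅ (by simp)).mono (Nat.add_le_add_right hlen 1)
    simpa [avoiding] using this
  refine (congrArg (IsUnionOfCNF k _) ?_).mp (((h true).union (h false)).mono
    (t := 2 * ((2 * n + 1) ^ k + 1) ^ 2) (le_of_eq (by ring)))
  ext x
  simp only [Set.mem_union, Set.mem_inter_iff, Set.mem_ofPred_eq]
  cases L.eval x <;> cases L'.eval x <;> simp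

/-- Each piece has at most the mass of `A`, so `h` applies to it; the union bound does the rest. -/
theorem IsUnionOfCNF.real_ballAround_le {n k t : ℕ} {A : Set (Cube n)} (hA : IsUnionOfCNF k t A)
    {D : PMF (Cube n)} {ρ γ η : ℝ} (hη : 0 ≤ η)
    (h : ∀ Φ : Set (Conj n), (∀ K ∈ Φ, K.length ≤ k) → D.toMeasure.real (_root_.avoiding Φ) < γ →
      D.toMeasure.real (ballAround ρ (_root_.avoiding Φ)) ≤ η)
    (hlt : D.toMeasure.real A < γ) : D.toMeasure.real (ballAround ρ A) ≤ t * η := by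
  obtain ⟨F, hF, hFk, rfl⟩ := hA
  have hle : D.toMeasure.real (ballAround ρ {x | ∃ Φ ∈ F, x ∈ _root_.avoiding Φ})
      ≤ F.length * η := by
    clear hF
    induction F with
    | nil =>
      have : ballAround ρ {x | ∃ Φ ∈ ([] : List (Set (Conj n))), x ∈ _root_.avoiding Φ} = ∅ := by
        ext x
        simp [ballAround]
      rw [this]
      simp
    | cons Φ F ih =>
      have h1 := ih (fun Ψ h => hFk Ψ (List.mem_cons_of_mem _ h))
        (lt_of_le_of_lt (measureReal_mono (Set.ofPred_subset_ofPred.2 fun x ⟨Ψ, hΨ, hx⟩ =>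
          ⟨Ψ, List.mem_cons_of_mem _ hΨ, hx⟩)) hlt)
      have h2 := h Φ (hFk Φ (by simp))
        (lt_of_le_of_lt (measureReal_mono (show _root_.avoiding Φ ⊆
          {x | ∃ Ψ ∈ Φ :: F, x ∈ _root_.avoiding Ψ} from fun x hx => ⟨Φ, by simp, hx⟩)) hlt)
      have hsub : ballAround ρ {x | ∃ Ψ ∈ Φ :: F, x ∈ _root_.avoiding Ψ} ⊆
          ballAround ρ (_root_.avoiding Φ) ∪
            ballAround ρ {x | ∃ Ψ ∈ F, x ∈ _root_.avoiding Ψ} := by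
        rintro x ⟨z, hz, Ψ, hΨ, hzΨ⟩
        rcases List.mem_cons.1 hΨ with rfl | hΨ
        · exact Or.inl ⟨z, hz, hzΨ⟩
        · exact Or.inr ⟨z, hz, Ψ, hΨ, hzΨ⟩
      have h3 := (measureReal_mono (μ := D.toMeasure) hsub).trans (measureReal_union_le _ _)
      rw [List.length_cons, Nat.cast_add_one]
      linarith
  exact hle.trans (mul_le_mul_of_nonneg_right (by exact_mod_cast hF) hη)

/-! ### Rivest's algorithm: correctness and running time -/

@[simp] theorem Timed.val_pure {β : Type} (b : β) : (pure b : Timed β).val = b := rfl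

@[simp] theorem Timed.steps_pure {β : Type} (b : β) : (pure b : Timed β).steps = 0 := rfl

@[simp] theorem Timed.val_bind {β γ : Type} (t : Timed β) (f : β → Timed γ) :
    (t >>= f).val = (f t.val).val := rfl

@[simp] theorem Timed.steps_bind {β γ : Type} (t : Timed β) (f : β → Timed γ) :
    (t >>= f).steps = t.steps + (f t.val).steps := rfl

@[simp] theorem steps_tick : tick.steps = 1 := rfl

theorem satT_steps_le {n : ℕ} (x : Cube n) (K : Conj n) : (satT x K).steps ≤ K.length + 1 := by
  induction K with
  | nil => simp [satT]
  | cons l K ih =>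
    simp only [satT, Timed.steps_bind, steps_tick, List.length_cons]
    split_ifs
    · omega
    · simp

theorem evalT_steps_le {n k : ℕ} (x : Cube n) (L : DecList n) (hL : ∀ N ∈ L, N.1.length ≤ k) :
    (evalT x L).steps ≤ L.length * (k + 2) + 1 := by
  induction L with
  | nil => simp [evalT]
  | cons N L ih =>
    obtain ⟨K, v⟩ := N
    have ih := ih fun N hN => hL N (List.mem_cons_of_mem _ hN)
    have h := satT_steps_le x K
    have hK : K.length ≤ k := hL (K, v) (by simp)
    simp only [evalT, Timed.steps_bind, steps_tick, List.length_cons, Nat.succ_mul]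
    split_ifs
    · simp; omega
    · omega

theorem someSatT_val {n : ℕ} (K : Conj n) (S : List (Cube n × Bool)) :
    (someSatT K S).val = true ↔ ∃ e ∈ S, Conj.sat K e.1 = true := by
  induction S with
  | nil => simp [someSatT]
  | cons e S ih =>
    simp only [someSatT, Timed.val_bind, satT_val]
    split_ifs with h
    · simp [h]
    · simp [h, ih]

theorem someSatT_steps_le {n : ℕ} (K : Conj n) (S : List (Cube n × Bool)) :
    (someSatT K S).steps ≤ S.length * (K.length + 2) + 1 := by
  induction S with
  | nil => simp [someSatT]
  | cons e S ih =>
    have h := satT_steps_le e.1 K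
    simp only [someSatT, Timed.steps_bind, steps_tick, List.length_cons, Nat.succ_mul]
    split_ifs
    · simp; omega
    · omega

theorem allLabelT_val {n : ℕ} (K : Conj n) (b : Bool) (S : List (Cube n × Bool)) :
    (allLabelT K b S).val = true ↔ ∀ e ∈ S, Conj.sat K e.1 = true → e.2 = b := by
  induction S with
  | nil => simp [allLabelT]
  | cons e S ih =>
    simp only [allLabelT, Timed.val_bind, satT_val, List.forall_mem_cons]
    split_ifs with h
    · simp only [Bool.and_eq_true, bne_iff_ne] at h
      simp [h]
    · simp only [Bool.and_eq_true, bne_iff_ne, not_and, not_not] at h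
      simp [ih]
      exact fun _ => h

theorem allLabelT_steps_le {n : ℕ} (K : Conj n) (b : Bool) (S : List (Cube n × Bool)) :
    (allLabelT K b S).steps ≤ S.length * (K.length + 2) + 1 := by
  induction S with
  | nil => simp [allLabelT]
  | cons e S ih =>
    have h := satT_steps_le e.1 K
    simp only [allLabelT, Timed.steps_bind, steps_tick, List.length_cons, Nat.succ_mul]
    split_ifs
    · simp; omega
    · omega

theorem removeT_val {n : ℕ} (K : Conj n) (S : List (Cube n × Bool)) :
    (removeT K S).val = S.filter fun e => !Conj.sat K e.1 := by
  induction S with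
  | nil => simp [removeT]
  | cons e S ih =>
    simp only [removeT, Timed.val_bind, satT_val]
    split_ifs with h
    · simp [h, ih]
    · simp [h, ih]

theorem removeT_steps_le {n : ℕ} (K : Conj n) (S : List (Cube n × Bool)) :
    (removeT K S).steps ≤ S.length * (K.length + 2) + 1 := by
  induction S with
  | nil => simp [removeT]
  | cons e S ih =>
    have h := satT_steps_le e.1 K
    simp only [removeT, Timed.steps_bind, steps_tick, List.length_cons, Nat.succ_mul]
    split_ifs
    · simp; omega
    · simp; omega

/-- The conjunction of the node is satisfied by some example, and all the examples that satisfy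
it have the value of the node as their label. -/
def IsValidNode {n : ℕ} (S : List (Cube n × Bool)) (N : Conj n × Bool) : Prop :=
  (∃ e ∈ S, Conj.sat N.1 e.1 = true) ∧ ∀ e ∈ S, Conj.sat N.1 e.1 = true → e.2 = N.2

theorem nodeT_eq_some {n : ℕ} {S : List (Cube n × Bool)} {K : Conj n} {N : Conj n × Bool}
    (h : (nodeT S K).val = some N) : N.1 = K ∧ IsValidNode S N := by
  simp only [nodeT, Timed.val_bind] at h
  split_ifs at h with h1
  · simp only [Timed.val_bind] at h
    split_ifs at h with h2
    · obtain rfl : (K, false) = N := by simpa using h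
      exact ⟨rfl, (someSatT_val K S).1 h1, (allLabelT_val K false S).1 h2⟩
    · simp only [Timed.val_bind] at h
      split_ifs at h with h3
      · obtain rfl : (K, true) = N := by simpa using h
        exact ⟨rfl, (someSatT_val K S).1 h1, (allLabelT_val K true S).1 h3⟩

theorem nodeT_ne_none {n : ℕ} {S : List (Cube n × Bool)} {N : Conj n × Bool}
    (h : IsValidNode S N) : (nodeT S N.1).val ≠ none := by
  obtain ⟨K, v⟩ := N
  have h1 := (someSatT_val K S).2 h.1
  have h2 := (allLabelT_val K v S).2 h.2
  cases v
  · simp [nodeT, h1, h2]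
  · simp only [nodeT, Timed.val_bind, h1, if_true]
    split_ifs <;> simp [h2]

theorem nodeT_steps_le {n : ℕ} (S : List (Cube n × Bool)) (K : Conj n) :
    (nodeT S K).steps ≤ 3 * (S.length * (K.length + 2)) + 4 := by
  have h1 := someSatT_steps_le K S
  have h2 := allLabelT_steps_le K false S
  have h3 := allLabelT_steps_le K true S
  simp only [nodeT, Timed.steps_bind, steps_tick]
  split_ifs
  · simp only [Timed.steps_bind]
    split_ifs
    · simp; omega
    · simp only [Timed.steps_bind]
      split_ifs <;> simp <;> omega
  · simp; omega

theorem firstT_eq_some {ι β : Type} {f : ι → Timed (Option β)} {is : List ι} {r : β}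
    (h : (firstT f is).val = some r) : ∃ i ∈ is, (f i).val = some r := by
  induction is with
  | nil => simp [firstT] at h
  | cons i is ih =>
    rcases hf : (f i).val with _ | r'
    · simp only [firstT, Timed.val_bind, hf] at h
      obtain ⟨j, hj, h⟩ := ih h
      exact ⟨j, List.mem_cons_of_mem _ hj, h⟩
    · simp only [firstT, Timed.val_bind, hf, Timed.val_pure] at h
      exact ⟨i, by simp, hf.trans h⟩

theorem firstT_eq_none {ι β : Type} {f : ι → Timed (Option β)} {is : List ι}
    (h : (firstT f is).val = none) : ∀ i ∈ is, (f i).val = none := by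
  induction is with
  | nil => simp
  | cons i is ih =>
    rcases hf : (f i).val with _ | r'
    · simp only [firstT, Timed.val_bind, hf] at h
      exact List.forall_mem_cons.2 ⟨hf, ih h⟩
    · simp [firstT, hf] at h

theorem firstT_steps_le {ι β : Type} {f : ι → Timed (Option β)} {is : List ι} {t : ℕ}
    (h : ∀ i ∈ is, (f i).steps ≤ t) : (firstT f is).steps ≤ is.length * (t + 1) + 1 := by
  induction is with
  | nil => simp [firstT]
  | cons i is ih =>
    have h1 := h i (by simp)
    have ih := ih fun j hj => h j (List.mem_cons_of_mem _ hj)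
    rcases hf : (f i).val with _ | r' <;>
      simp only [firstT, Timed.steps_bind, hf, steps_tick, List.length_cons, Nat.succ_mul,
        Timed.steps_pure] <;> omega

theorem searchT_eq_some {n k : ℕ} {S : List (Cube n × Bool)} {K : Conj n} {N : Conj n × Bool}
    (h : (searchT S k K).val = some N) : N.1.length ≤ K.length + k ∧ IsValidNode S N := by
  induction k generalizing K with
  | zero =>
    obtain ⟨rfl, h'⟩ := nodeT_eq_some h
    exact ⟨le_rfl, h'⟩
  | succ k ih =>
    rcases hn : (nodeT S K).val with _ | N'
    · simp only [searchT, Timed.val_bind, hn] at h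
      obtain ⟨i, -, h⟩ := firstT_eq_some h
      obtain ⟨b, -, h⟩ := firstT_eq_some h
      obtain ⟨h1, h2⟩ := ih h
      exact ⟨by simp at h1; omega, h2⟩
    · simp only [searchT, Timed.val_bind, hn, Timed.val_pure] at h
      obtain ⟨rfl, h⟩ := nodeT_eq_some (hn.trans h)
      exact ⟨Nat.le_add_right _ _, h⟩

theorem searchT_eq_none {n k : ℕ} {S : List (Cube n × Bool)} {K : Conj n}
    (h : (searchT S k K).val = none) (K' : Conj n) (hK' : K'.length ≤ k) :
    (nodeT S (K' ++ K)).val = none := by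
  induction k generalizing K K' with
  | zero =>
    rw [List.eq_nil_of_length_eq_zero (Nat.le_zero.1 hK')]
    exact h
  | succ k ih =>
    rcases hn : (nodeT S K).val with _ | N'
    -- The search prepends literals, so the literal of `K'` added first is its last one.
    · rcases List.eq_nil_or_concat K' with rfl | ⟨K₀, l, rfl⟩
      · exact hn
      · simp only [searchT, Timed.val_bind, hn] at h
        have h1 := firstT_eq_none (firstT_eq_none h l.1 (List.mem_finRange _)) l.2 (by
          cases l.2 <;> simp)
        have := ih h1 K₀ (by simpa using hK')
        simpa using this
    · simp [searchT, hn] at h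

/-- The recursion depth is fixed and each level branches over `2n` literals, so the degree grows
with `j` only. -/
theorem exists_searchT_bound (k j : ℕ) : ∃ r : MvPolynomial (Fin 2) ℕ,
    ∀ (n m : ℕ) (S : List (Cube n × Bool)) (K : Conj n), S.length ≤ m → K.length + j ≤ k →
      (searchT S j K).steps ≤ r.eval ![n, m] := by
  have hnode : ∀ (n m : ℕ) (S : List (Cube n × Bool)) (K : Conj n), S.length ≤ m →
      K.length ≤ k → (nodeT S K).steps ≤ 3 * (m * (k + 2)) + 4 := by
    intro n m S K hS hK
    have := Nat.mul_le_mul hS (Nat.add_le_add_right hK 2)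
    have := nodeT_steps_le S K
    omega
  induction j with
  | zero =>
    refine ⟨3 * (.X 1 * (.C k + 2)) + 4, fun n m S K hS hK => ?_⟩
    simpa [searchT] using hnode n m S K hS hK
  | succ j ih =>
    obtain ⟨r, hr⟩ := ih
    refine ⟨(3 * (.X 1 * (.C k + 2)) + 4) + (.X 0 * (2 * (r + 1) + 1 + 1) + 1),
      fun n m S K hS hK => ?_⟩
    have h1 := hnode n m S K hS (by omega)
    have h2 : ∀ (i : Fin n) (b : Bool), (searchT S j ((i, b) :: K)).steps ≤ r.eval ![n, m] :=
      fun i b => hr n m S _ hS (by simp; omega)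
    have h3 : ∀ i : Fin n, (firstT (fun b => searchT S j ((i, b) :: K)) [false, true]).steps
        ≤ 2 * (r.eval ![n, m] + 1) + 1 := fun i => firstT_steps_le fun b _ => h2 i b
    have h4 : (firstT (fun i => firstT (fun b => searchT S j ((i, b) :: K)) [false, true])
        (List.finRange n)).steps ≤ n * (2 * (r.eval ![n, m] + 1) + 1 + 1) + 1 := by
      simpa using firstT_steps_le (is := List.finRange n) fun i _ => h3 i
    simp only [map_add, map_mul, map_ofNat, MvPolynomial.eval_X, MvPolynomial.eval_C, map_one,
      Matrix.cons_val_zero, Matrix.cons_val_one]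
    rcases hn : (nodeT S K).val with _ | N <;>
      simp only [searchT, Timed.steps_bind, hn, Timed.steps_pure] <;> omega

theorem rivestLoopT_length_le (k : ℕ) {n : ℕ} (F S : List (Cube n × Bool)) :
    (rivestLoopT k F S).val.length ≤ F.length + 1 := by
  induction F generalizing S with
  | nil => simp [rivestLoopT]
  | cons e F ih =>
    simp only [rivestLoopT, Timed.val_bind]
    split_ifs
    · simp
    · simp only [Timed.val_bind]
      split_ifs
      · simp
      · simp only [Timed.val_bind]
        rcases (searchT S k []).val with _ | N
        · simp
        · simpa using ih _

theorem rivestLoopT_isKDL (k : ℕ) {n : ℕ} (F S : List (Cube n × Bool)) :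
    DecList.IsKDL k (rivestLoopT k F S).val := by
  have hone : ∀ b : Bool, DecList.IsKDL k [(([] : Conj n), b)] := fun b =>
    ⟨by simp, b, rfl⟩
  induction F generalizing S with
  | nil => exact hone false
  | cons e F ih =>
    simp only [rivestLoopT, Timed.val_bind]
    split_ifs
    · exact hone false
    · simp only [Timed.val_bind]
      split_ifs
      · exact hone true
      · simp only [Timed.val_bind]
        rcases hs : (searchT S k []).val with _ | N
        · exact hone false
        · obtain ⟨h1, v, h2⟩ := ih (removeT N.1 S).val
          refine ⟨List.forall_mem_cons.2 ⟨by simpa using (searchT_eq_some hs).1, h1⟩, v, ?_⟩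
          simp only [Timed.val_bind, Timed.val_pure]
          rw [List.getLast?_cons, h2]
          rfl

/-- A non-empty sample labelled by a `k`-decision list has a valid node with at most `k`
literals. -/
theorem exists_validNode {n k : ℕ} {L : DecList n} (hL : DecList.IsKDL k L)
    {S : List (Cube n × Bool)} (hS : ∀ e ∈ S, e.2 = DecList.eval L e.1) (hne : S ≠ []) :
    ∃ N : Conj n × Bool, N.1.length ≤ k ∧ IsValidNode S N := by
  obtain ⟨hk, u, hu⟩ := hL
  induction L with
  | nil => simp at hu
  | cons N L ih =>
    by_cases h : ∃ e ∈ S, Conj.sat N.1 e.1 = true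
    · refine ⟨N, hk N (by simp), h, fun e he hs => ?_⟩
      rw [hS e he]
      simp [DecList.eval, hs]
    -- No example is caught by this node, so the tail labels the sample; the final node `true`
    -- catches every example.
    · push Not at h
      cases L with
      | nil =>
        obtain ⟨e, he⟩ := List.exists_mem_of_ne_nil S hne
        obtain rfl : N = ([], u) := by simpa using hu
        exact absurd rfl (h e he)
      | cons N' L =>
        refine ih (fun e he => ?_) (fun M hM => hk M (List.mem_cons_of_mem _ hM))
          (by simpa using hu)
        rw [hS e he]
        conv_lhs => rw [DecList.eval]
        rw [if_neg (h e he)]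

/-- An emitted node is right on the examples it catches, and the others remain labelled by `L`. A
valid node catches an example, so the bound `F` on the rounds is not exhausted early. -/
theorem rivestLoopT_consistent {n k : ℕ} {L : DecList n} (hL : DecList.IsKDL k L)
    (F S : List (Cube n × Bool)) (hS : ∀ e ∈ S, e.2 = DecList.eval L e.1)
    (hF : S.length ≤ F.length) :
    ∀ e ∈ S, DecList.eval (rivestLoopT k F S).val e.1 = e.2 := by
  induction F generalizing S with
  | nil => simp [List.eq_nil_of_length_eq_zero (Nat.le_zero.1 hF)]
  | cons f F ih =>
    intro e he
    have hone : ∀ b : Bool, (allLabelT [] b S).val = true →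
        DecList.eval [([], b)] e.1 = e.2 := fun b hb =>
      ((allLabelT_val [] b S).1 hb e he rfl).symm
    simp only [rivestLoopT, Timed.val_bind]
    split_ifs with h1
    · exact hone false h1
    · simp only [Timed.val_bind]
      split_ifs with h2
      · exact hone true h2
      · simp only [Timed.val_bind]
        rcases hs : (searchT S k []).val with _ | N
        · obtain ⟨N, hNk, hN⟩ := exists_validNode hL hS (List.ne_nil_of_mem he)
          have := searchT_eq_none hs N.1 hNk
          rw [List.append_nil] at this
          exact absurd this (nodeT_ne_none hN)
        · obtain ⟨-, ⟨e', he', hs'⟩, hN⟩ := searchT_eq_some hs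
          obtain ⟨K, v⟩ := N
          simp only [Timed.val_bind, Timed.val_pure, DecList.eval]
          by_cases hse : Conj.sat K e.1 = true
          · rw [if_pos hse, hN e he hse]
          · rw [if_neg hse]
            refine ih _ ?_ ?_ e ?_
            · intro a ha
              rw [removeT_val] at ha
              exact hS a (List.mem_filter.1 ha).1
            · rw [removeT_val]
              have : (S.filter fun e => !Conj.sat K e.1).length < S.length :=
                List.length_filter_lt_length_iff_exists.2 ⟨e', he', by simpa using hs'⟩
              simp only [List.length_cons] at hF
              omega
            · rw [removeT_val]
              exact List.mem_filter.2 ⟨he, by simpa using hse⟩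

theorem rivest_mem_kDL (k : ℕ) {n m : ℕ} (S : Fin m → Cube n × Bool) :
    rivest k n m S ∈ kDL k n :=
  ⟨_, rivestLoopT_isKDL k _ _, fun _ => rfl⟩

theorem rivest_consistent {k n m : ℕ} {c : Cube n → Bool} (hc : c ∈ kDL k n)
    (S : Fin m → Cube n) (i : Fin m) : rivest k n m (labelled c S) (S i) = c (S i) := by
  obtain ⟨L, hL, hcL⟩ := hc
  refine rivestLoopT_consistent hL _ _ (fun e he => ?_) le_rfl (labelled c S i)
    (List.mem_ofFn.2 ⟨i, rfl⟩)
  obtain ⟨j, rfl⟩ := List.mem_ofFn.1 he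
  exact hcL _

theorem exists_rivestLoopT_bound (k : ℕ) : ∃ r : MvPolynomial (Fin 2) ℕ,
    ∀ (n m : ℕ) (F S : List (Cube n × Bool)), S.length ≤ m →
      (rivestLoopT k F S).steps ≤ F.length * r.eval ![n, m] + 1 := by
  obtain ⟨r, hr⟩ := exists_searchT_bound k k
  refine ⟨2 * (.X 1 * 2 + 1) + r + (.X 1 * (.C k + 2) + 1) + 2, fun n m F S hS => ?_⟩
  simp only [map_add, map_mul, map_ofNat, MvPolynomial.eval_X, MvPolynomial.eval_C, map_one,
    Matrix.cons_val_one, Matrix.cons_val_zero]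
  induction F generalizing S with
  | nil => simp [rivestLoopT]
  | cons e F ih =>
    have hlab : ∀ b : Bool, (allLabelT [] b S).steps ≤ m * 2 + 1 := fun b => by
      have := allLabelT_steps_le [] b S
      simp only [List.length_nil] at this
      omega
    have h1 := hlab false
    have h2 := hlab true
    have h3 := hr n m S [] hS (by simp)
    rw [List.length_cons, Nat.succ_mul]
    simp only [rivestLoopT, Timed.steps_bind, steps_tick]
    split_ifs
    · simp; omega
    · simp only [Timed.steps_bind]
      split_ifs
      · simp; omega
      · simp only [Timed.steps_bind]
        rcases hs : (searchT S k []).val with _ | N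
        · simp; omega
        · have hNk : N.1.length ≤ k := by simpa using (searchT_eq_some hs).1
          have h4 := removeT_steps_le N.1 S
          have h5 := Nat.mul_le_mul hS (Nat.add_le_add_right hNk 2)
          have h6 := ih (removeT N.1 S).val (by
            rw [removeT_val]
            exact (List.length_filter_le _ _).trans hS)
          simp only [Timed.steps_bind, Timed.steps_pure]
          omega

theorem rivest_runsInPolyTime (k : ℕ) : RivestRunsInPolyTime k := by
  obtain ⟨r, hr⟩ := exists_rivestLoopT_bound k
  refine ⟨(.X 1 * r + 1) + ((.X 1 + 1) * (.C k + 2) + 1), fun n m S => ?_⟩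
  simp only [map_add, map_mul, map_ofNat, MvPolynomial.eval_X, MvPolynomial.eval_C, map_one,
    Matrix.cons_val_one, Matrix.cons_val_zero]
  constructor
  · have := hr n m (List.ofFn S) (List.ofFn S) (by simp)
    rw [List.length_ofFn] at this
    exact this.trans (Nat.le_add_right _ _)
  · intro x
    have h1 := evalT_steps_le x _ (rivestLoopT_isKDL k (List.ofFn S) (List.ofFn S)).1
    have h2 := rivestLoopT_length_le k (List.ofFn S) (List.ofFn S)
    rw [List.length_ofFn] at h2
    have h3 := Nat.mul_le_mul_right (k + 2) h2
    unfold rivestT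
    omega

/-! ### Sample complexity of consistent learners -/

instance {n : ℕ} (D : PMF (Cube n)) (m : ℕ) : IsProbabilityMeasure (sampleLaw D m) := by
  unfold sampleLaw
  infer_instance

theorem sampleLaw_real_forall_mem {n : ℕ} (D : PMF (Cube n)) (m : ℕ) (A : Set (Cube n)) :
    (sampleLaw D m).real {S | ∀ i, S i ∈ A} = D.toMeasure.real A ^ m := by
  have h : {S : Fin m → Cube n | ∀ i, S i ∈ A} = Set.univ.pi fun _ => A := by
    ext S
    simp
  rw [h, measureReal_def, sampleLaw, Measure.pi_pi]
  simp [measureReal_def]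

/-- A learner that outputs consistent hypotheses from a finite set is probably approximately
correct. -/
theorem one_sub_le_real_stdError_le {n m : ℕ} {H : Finset (Cube n → Bool)} {c : Cube n → Bool}
    (D : PMF (Cube n)) {out : (Fin m → Cube n) → Cube n → Bool} (hH : ∀ S, out S ∈ H)
    (hout : ∀ S i, out S (S i) = c (S i)) {ε δ : ℝ}
    (hle : H.card * Real.exp (-(ε * m)) ≤ δ) :
    1 - δ ≤ (sampleLaw D m).real {S | stdError D (out S) c ≤ ε} := by
  classical
  have hbad : (sampleLaw D m).real {S | ¬ stdError D (out S) c ≤ ε} ≤ δ := by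
    -- On failure some hypothesis in `H` of error above `ε` agrees with the whole sample; a union
    -- bound over these follows.
    refine le_trans ?_ hle
    have hsub : {S : Fin m → Cube n | ¬ stdError D (out S) c ≤ ε} ⊆
        ⋃ h ∈ H.filter fun h => ε < stdError D h c, {S | ∀ i, S i ∈ {x | c x = h x}} := by
      intro S hS
      refine Set.mem_biUnion (x := out S) ?_ fun i => (hout S i).symm
      exact Finset.mem_coe.2 (Finset.mem_filter.2 ⟨hH S, not_le.1 hS⟩)
    calc _ ≤ _ := measureReal_mono hsub (measure_ne_top _ _)
      _ ≤ ∑ h ∈ H.filter fun h => ε < stdError D h c,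
            (sampleLaw D m).real {S | ∀ i, S i ∈ {x | c x = h x}} :=
          measureReal_biUnion_finset_le _ _
      _ ≤ ∑ _h ∈ H.filter fun h => ε < stdError D h c, Real.exp (-(ε * m)) := by
          refine Finset.sum_le_sum fun h hh => ?_
          rw [sampleLaw_real_forall_mem]
          have h1 : ε < D.toMeasure.real {x | c x ≠ h x} := (Finset.mem_filter.1 hh).2
          have h2 : D.toMeasure.real {x | c x = h x}
              = 1 - D.toMeasure.real {x | c x ≠ h x} := by
            rw [← probReal_compl_eq_one_sub (Set.toFinite _).measurableSet]
            congr 1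
            ext x
            simp
          calc D.toMeasure.real {x | c x = h x} ^ m ≤ Real.exp (-ε) ^ m := by
                refine pow_le_pow_left₀ measureReal_nonneg ?_ m
                linarith [Real.add_one_le_exp (-ε)]
            _ = Real.exp (-(ε * m)) := by rw [← Real.exp_nat_mul]; congr 1; ring
      _ ≤ H.card * Real.exp (-(ε * m)) := by
          rw [Finset.sum_const, nsmul_eq_mul]
          exact mul_le_mul_of_nonneg_right (by exact_mod_cast Finset.card_filter_le _ _)
            (Real.exp_pos _).le
  have htot : (1 : ℝ) ≤ (sampleLaw D m).real {S | stdError D (out S) c ≤ ε} +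
      (sampleLaw D m).real {S | ¬ stdError D (out S) c ≤ ε} := by
    refine le_trans (le_of_eq ?_) (measureReal_union_le _ _)
    have : {S | stdError D (out S) c ≤ ε} ∪ {S | ¬ stdError D (out S) c ≤ ε} = Set.univ := by
      ext S
      simp [le_or_gt]
    rw [this, probReal_univ]
  linarith

theorem rivest_properlyPACLearns (k : ℕ) : ProperlyPACLearns (rivest k) (kDL k) (kDLSize k) := by
  refine ⟨fun n c _ m S => rivest_mem_kDL k _,
    -- With `T = (2n + 1) ^ k`, the class has at most `exp (2T²)` members; `1/δ` replaces `log
    -- (1/δ)` to give a polynomial.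
    .X 1 * (2 * ((2 * .X 0 + 1) ^ k) ^ 2 + .X 2), ?_⟩
  intro n c hc D ε δ hε _ hδ _ m hm
  obtain ⟨H, hH, hcard⟩ := kDL.exists_finset n k
  refine one_sub_le_real_stdError_le D (fun S => hH (rivest_mem_kDL k _))
    (fun S i => rivest_consistent hc S i) ?_
  have hm' : 1 / ε * (2 * ((2 * (n : ℝ) + 1) ^ k) ^ 2 + 1 / δ) ≤ m := by
    simpa [params] using hm
  set T : ℝ := (2 * (n : ℝ) + 1) ^ k with hT
  have hT0 : 0 ≤ T := by positivity
  have h1 : 2 * T ^ 2 + 1 / δ ≤ ε * m := by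
    rw [one_div_mul_eq_div, div_le_iff₀ hε] at hm'
    linarith
  have h2 : (H.card : ℝ) ≤ Real.exp (2 * T ^ 2) := by
    calc (H.card : ℝ) ≤ (2 * T + 1) ^ (2 * n + 1) ^ k := by
          rw [hT]; exact_mod_cast hcard
      _ ≤ Real.exp (2 * T) ^ (2 * n + 1) ^ k :=
          pow_le_pow_left₀ (by positivity) (Real.add_one_le_exp _) _
      _ = Real.exp (2 * T ^ 2) := by
          rw [← Real.exp_nat_mul]
          congr 1
          push_cast
          rw [← hT]
          ring
  have h3 : Real.exp (-(1 / δ)) ≤ δ := by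
    rw [Real.exp_neg]
    refine inv_le_of_inv_le₀ hδ ?_
    rw [← one_div]
    linarith [Real.add_one_le_exp (1 / δ)]
  calc (H.card : ℝ) * Real.exp (-(ε * m))
      ≤ Real.exp (2 * T ^ 2) * Real.exp (-(2 * T ^ 2 + 1 / δ)) :=
        mul_le_mul h2 (Real.exp_le_exp.2 (neg_le_neg h1)) (Real.exp_pos _).le (Real.exp_pos _).le
    _ = Real.exp (-(1 / δ)) := by rw [← Real.exp_add]; congr 1; ring
    _ ≤ δ := h3

/-! ### From the standard error to the robust risk -/

/-- The logarithmic radius enters here: `2 ^ log_b n = n ^ (log 2 / log b)` is polynomial in `n`.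
For `n = 0` the convention `log 0 = 0` gives radius 0. -/
theorem two_rpow_logb_le {b : ℝ} (hb : 1 < b) {n : ℕ} {Y : ℝ} (hY : 1 ≤ Y) (hn : (n : ℝ) ≤ Y) :
    (2 : ℝ) ^ Real.logb b n ≤ Y ^ ⌈Real.log 2 / Real.log b⌉₊ := by
  rcases Nat.eq_zero_or_pos n with rfl | hpos
  · simpa using one_le_pow₀ hY
  · have hn0 : (0 : ℝ) < n := by exact_mod_cast hpos
    have hlb := Real.log_pos hb
    rw [← Real.rpow_natCast, Real.rpow_def_of_pos (by norm_num), Real.rpow_def_of_pos (by linarith),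
      Real.exp_le_exp]
    calc Real.log 2 * Real.logb b n = Real.log n * (Real.log 2 / Real.log b) := by
          rw [Real.logb]; ring
      _ ≤ Real.log Y * ⌈Real.log 2 / Real.log b⌉₊ := by
          refine mul_le_mul (Real.log_le_log hn0 hn) (Nat.le_ceil _) ?_ (Real.log_nonneg hY)
          have := Real.log_nonneg (by norm_num : (1 : ℝ) ≤ 2)
          positivity

/-- For `k`-decision lists and log-Lipschitz distributions, a polynomially small standard error
makes the robust risk small for logarithmic radii. -/
theorem exists_robustRisk_lt {k : ℕ} (hk : 1 ≤ k) {α : ℝ} (hα : 1 ≤ α) {b : ℝ} (hb : 1 < b) :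
    ∃ P : MvPolynomial (Fin 4) ℝ, ∀ (n : ℕ) (ε δ : ℝ) (s : ℕ), 0 < ε →
      2 < P.eval (params n ε δ s) ∧
      ∀ D : PMF (Cube n), IsLogLipschitz α D → ∀ h ∈ kDL k n, ∀ c ∈ kDL k n,
        stdError D h c ≤ 1 / P.eval (params n ε δ s) →
          robustRisk D (Real.logb b n) h c < ε := by
  obtain ⟨d, hd⟩ := exists_expansion_exponent hα k ⌈Real.log 2 / Real.log b⌉₊
  -- The base `Y` of the power exceeds `n`, which controls the radius, and `T / ε` for the number
  -- `T` of CNF pieces, so that `T * Y⁻¹ < ε`. The outer `2 * _ + 1` makes the value exceed both `Y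
  -- ^ d` and 2.
  refine ⟨2 * (2 * ((2 * .X 0 + 1) ^ k + 1) ^ 2 * (.X 1 + 1) + .X 0 + 2) ^ d + 1,
    fun n ε δ s hε => ?_⟩
  have heval : MvPolynomial.eval (params n ε δ s)
      (2 * (2 * ((2 * .X 0 + 1) ^ k + 1) ^ 2 * (.X 1 + 1) + .X 0 + 2) ^ d + 1)
      = 2 * (2 * ((2 * (n : ℝ) + 1) ^ k + 1) ^ 2 * (1 / ε + 1) + n + 2) ^ d + 1 := by
    simp [params]
  rw [heval]
  set T : ℝ := 2 * ((2 * (n : ℝ) + 1) ^ k + 1) ^ 2 with hT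
  have hT0 : 0 < T := by positivity
  set Y : ℝ := T * (1 / ε + 1) + n + 2 with hY
  have hpos : 0 < T * (1 / ε + 1) := by positivity
  have hn0 : (0 : ℝ) ≤ n := n.cast_nonneg
  have hY2 : 2 ≤ Y := by linarith
  have hYd : 1 ≤ Y ^ d := one_le_pow₀ (by linarith)
  refine ⟨by linarith, fun D hD h hh c hc herr => ?_⟩
  have hcnf := kDL.isUnionOfCNF_ne hk hh hc
  have hlt : D.toMeasure.real {x | h x ≠ c x} < (Y ^ d)⁻¹ := by
    have : {x | h x ≠ c x} = {x | c x ≠ h x} := by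
      ext x
      exact ne_comm
    rw [this]
    refine lt_of_le_of_lt herr ?_
    rw [← one_div]
    exact one_div_lt_one_div_of_lt (by linarith) (by linarith)
  have hmain := hcnf.real_ballAround_le (ρ := Real.logb b n) (η := Y⁻¹) (by positivity)
    (fun Φ hΦ h => hd Y hY2 _ (two_rpow_logb_le hb (by linarith) (by linarith)) n D hD Φ hΦ h) hlt
  refine lt_of_le_of_lt (b := T * Y⁻¹) ?_ ?_
  · rw [hT]
    refine le_trans hmain (le_of_eq ?_)
    push_cast
    ring
  · rw [← div_eq_mul_inv, div_lt_iff₀ (by linarith)]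
    have h1 : ε * (T * (1 / ε + 1)) = T + ε * T := by field_simp
    have h2 : 0 < ε * T := by positivity
    have h3 : 0 ≤ ε * n := by positivity
    rw [hY]
    nlinarith

/-- Every proper PAC learner for `k`-decision lists is a robust learner. -/
theorem ProperlyPACLearns.efficientlyRobustlyLearns {k : ℕ} (hk : 1 ≤ k) {α : ℝ} (hα : 1 ≤ α)
    {b : ℝ} (hb : 1 < b) {A : Learner} (hA : ProperlyPACLearns A (kDL k) (kDLSize k)) :
    EfficientlyRobustlyLearns A (kDL k) (kDLSize k) (logLipschitz α)
      (fun n => Real.logb b n) := by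
  obtain ⟨hproper, p, hp⟩ := hA
  obtain ⟨P, hP⟩ := exists_robustRisk_lt hk hα hb
  -- The PAC guarantee is used with accuracy `1/P` and confidence parameter `1/(2/δ + 3)`. The
  -- latter is below both `1/2` and `δ` for every `δ > 0`, which also gives the strict inequality.
  -- Substitution into `p` keeps the sample bound polynomial.
  refine ⟨MvPolynomial.bind₁ ![.X 0, P, 2 * .X 2 + 3, .X 3] p,
    (2 * .X 0 + 1) ^ k * (3 * .C (k : ℝ) + 3) + 1, ?_⟩
  intro n c hc D hD ε δ hε hδ m hm
  obtain ⟨hP2, hrisk⟩ := hP n ε δ (kDLSize k n c) hε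
  set v := P.eval (params n ε δ (kDLSize k n c)) with hv
  have hu : 2 < 2 * (1 / δ) + 3 := by
    have : 0 < 1 / δ := by positivity
    linarith
  set u : ℝ := 2 * (1 / δ) + 3 with hu'
  have hparams : params n (1 / v) (1 / u) (kDLSize k n c) = fun i =>
      MvPolynomial.eval (params n ε δ (kDLSize k n c))
        ((![.X 0, P, 2 * .X 2 + 3, .X 3] : Fin 4 → MvPolynomial (Fin 4) ℝ) i) := by
    funext i
    fin_cases i <;> simp [params, hv, hu']
  have huδ : 1 / u < δ := by
    rw [div_lt_iff₀ (by linarith), hu']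
    field_simp
    linarith
  have hm' : p.eval (params n (1 / v) (1 / u) (kDLSize k n c)) ≤ m := by
    rw [hparams]
    refine le_trans (le_of_eq ?_) hm
    simp only [← MvPolynomial.coe_aeval_eq_eval, RingHom.coe_coe, MvPolynomial.aeval_bind₁]
  have hhalf : ∀ t : ℝ, 2 < t → 0 < 1 / t ∧ 1 / t < 1 / 2 := fun t ht =>
    ⟨by positivity, one_div_lt_one_div_of_lt (by norm_num) ht⟩
  have h1 := hp n c hc D (1 / v) (1 / u) (hhalf v hP2).1 (hhalf v hP2).2 (hhalf u hu).1
    (hhalf u hu).2 m hm'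
  refine ⟨lt_of_lt_of_le (by linarith) (h1.trans (measureReal_mono
    (Set.ofPred_subset_ofPred.2 fun S hS => hrisk D hD _ (hproper n c hc m S) c hc hS))),
    fun S => ?_⟩
  have := kDL.hasCircuitOfSize (hproper n c hc m S)
  simpa [params] using this

/-- The class of `k`-decision lists is efficiently `log n`-robustly learnable (to any base `b` of
the logarithm) under `α`-log-Lipschitz distributions: Rivest's algorithm, which is a proper PAC
learner that runs in polynomial time, is such a robust learner, and so is every proper PAC learner
for the class that is used as a black box. -/
theorem mainTheorem7 (k : ℕ) (hk : 1 ≤ k) (α : ℝ) (hα : 1 ≤ α) (b : ℝ) (hb : 1 < b) :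
    EfficientlyRobustlyLearns (rivest k) (kDL k) (kDLSize k) (logLipschitz α)
        (fun n => Real.logb b n) ∧
      ProperlyPACLearns (rivest k) (kDL k) (kDLSize k) ∧
      RivestRunsInPolyTime k ∧
      ∀ A : Learner, ProperlyPACLearns A (kDL k) (kDLSize k) →
        EfficientlyRobustlyLearns A (kDL k) (kDLSize k) (logLipschitz α)
          (fun n => Real.logb b n) :=
  ⟨(rivest_properlyPACLearns k).efficientlyRobustlyLearns hk hα hb, rivest_properlyPACLearns k,
    rivest_runsInPolyTime k, fun _ hA => hA.efficientlyRobustlyLearns hk hα hb⟩
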